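/- **Setting.** Let $T>0$, $0\le\beta\le1$, $0<\delta\le1$, $\sigma_0>0$, $h\in\mathbb C\setminus\{0\}$, $E>0$. Let $p\in L^2(\mathbb R)$ be a real pulse with matched-filter response $g(t)=\int p(s)p(s-t)\,ds$, without intersymbol interference at spacing $T$ ($g(0)=1$, $g(nT)=0$ for $n\in\mathbb Z\setminus\{0\}$), whose Fourier transform $G$ ($G$ integrable, $g(t)=\int G(f)e^{j2\pi ft}df$) is continuous and positive for $|f|<\frac{1+\beta}{2T}$ and zero for $|f|\ge\frac{1+\beta}{2T}$. For $N=2M+1$ let $\bm G=\bm G_N$, $(\bm G)_{n,m}=g((n-m)\delta T)$, be the Toeplitz matrix of the FTN channel $\bm y=h\bm G\bm a+\bm\eta$, $\bm\eta\sim\mathcal{CN}(0,\sigma_0^2\bm G)$, let $\mathcal G(f)=\frac1{\delta T}\sum_{m\in\mathbb Z}G\big(\frac{f-m}{\delta T}\big)$ be its generating function, and let $\widehat{\bm G}=\bm D\,\mathrm{diag}(\mathcal G(i/N))_{i=-M}^{M}\,\bm D^\dagger$ be its large-$N$ (DFT) form, where $\bm D_{m,i}=\frac1{\sqrt N}e^{-j2\pi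 mi/N}$ ($0\le m\le N-1$, $-M\le i\le M$). For an input covariance matrix $\bm\Sigma\succeq0$ and a channel matrix $\bm A\in\{\bm G,\widehat{\bm G}\}$ the rate is $\frac1N\log_2\det\big(\bm I+\frac{|h|^2}{\sigma_0^2}\bm A\bm\Sigma\big)$. The symbol energy is $\frac1N\int\mathbb E|x(t)|^2dt$ with $x(t)=\sum_m a[m]p(t-m\delta T)$ for $\bm A=\bm G$, and $\frac1N\mathrm{tr}(\bm\Sigma\widehat{\bm G})$ for $\bm A=\widehat{\bm G}$; the received SNR is (symbol energy)$/(T\sigma_0^2)$. $\bm\Sigma$ is *optimal at received SNR $\rho$* if its received SNR is $\rho$ and no covariance matrix with received SNR at most $\rho$ has a larger rate. For a stationary input with power spectrum $S\ge0$ on $[-\frac12,\frac12]$, the symbol energy is $\int_{-1/2}^{1/2} S\mathcal G\,df$ (assumed finite) and the rate is $\int_{-1/2}^{1/2}\log_2\big(1+\frac{|h|^2}{\sigma_0^2}S\mathcal G\big)df$; optimality is defined in the same way. The fixed-transmit-SNR formulas with transmit power $P_k$ are $$\text{(i)}\quad \bm\Sigma=P_k\delta T\,\bm A^{-1}\quad\big(\tfrac1{1+\beta}\le\delta\le1\big),\qquad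 \text{(ii)}\quad \bm\Sigma=P_k\delta T\,\bm D\,\mathrm{diag}(\tilde\lambda_i)_{i=-M}^{M}\,\bm D^\dagger\quad\big(\delta<\tfrac1{1+\beta}\big),$$ where $\tilde\lambda_i=\frac{T}{(1+\beta)\,G(i/(N\delta T))}$ if $|i|<\frac Z2$ and $\tilde\lambda_i=0$ otherwise, $Z$ being the number of $i\in\{-M,\dots,M\}$ with $G(i/(N\delta T))\ne0$. **Statement.** Fix the received SNR at $\rho=\frac{E/T}{\sigma_0^2}$. The optimal covariance matrices are obtained by replacing $P_k$ with $\frac{E}{\delta T}$ in (i) and (ii). Precisely: 0. $\bm G_N$ and $\widehat{\bm G}_N$ are asymptotically equivalent: $\frac1N\|\bm G_N-\widehat{\bm G}_N\|_F^2\to0$ as $M\to\infty$. 1. If $\frac1{1+\beta}\le\delta\le1$, then for every $M$ and for both $\bm A=\bm G$ and $\bm A=\widehat{\bm G}$, the matrix $\bm A$ is positive definite, and (i) with $P_k=\frac E{\delta T}$ is the unique covariance matrix that is optimal at received SNR $\rho$. 2. If $\delta<\frac1{1+\beta}$, let $\phi(f)=\frac{T}{(1+\beta)G(f/(\delta T))}$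 for $|f|<\frac{\delta(1+\beta)}2$ and $\phi(f)=0$ otherwise, and let $\bm\Sigma_N$ be (ii) with $P_k=\frac E{\delta T}$. Then: - the spectrum $\frac{E}{\delta T}\,\delta T\,\phi$ is optimal at received SNR $\rho$, and every optimal spectrum $S$ satisfies $S\mathcal G=\frac{E}{\delta T}\,\delta T\,\phi\,\mathcal G$ almost everywhere on $[-\frac12,\frac12]$; - $\tilde\lambda_i=\phi(i/N)$ for all $|i|\le M$; - for every $M$, for the channel matrix $\widehat{\bm G}$, $\bm\Sigma_N$ is optimal at the received SNR that it has, and every $\bm\Sigma$ that is optimal at that SNR satisfies $\widehat{\bm G}\bm\Sigma\widehat{\bm G}=\widehat{\bm G}\bm\Sigma_N\widehat{\bm G}$; - the received SNR of $\bm\Sigma_N$ (for $\widehat{\bm G}$) tends to $\rho$ as $M\to\infty$; - for every $\varepsilon>0$ and all sufficiently large $M$, for the channel matrix $\widehat{\bm G}$, every covariance matrix with received SNR at most $\rho$ has rate at most that of $\bm\Sigma_N$ plus $\varepsilon$. -/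

import Mathlib

open MeasureTheory Filter Topology
open scoped ComplexOrder

noncomputable section

namespace FTN

/-- Matched filter response `g(t) = (p ⋆ p(-·))(t)` of a real pulse `p`. -/
def matchedResponse (p : ℝ → ℝ) (t : ℝ) : ℝ := ∫ s, p s * p (s - t)

/-- `p` is a finite-energy pulse without intersymbol interference at the Nyquist spacing `T`,
with roll-off `β`, and `G` is the (continuous-time) Fourier transform of its matched filter
response `g`. The transform relation is stated by Fourier inversion, so that pulses whose `g` is not
absolutely integrable (the sinc pulse, `β = 0`) are covered; continuity on the open band makes `G`
unique there, and at the band edges the value `0` is chosen. -/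
structure IsPulse (p G : ℝ → ℝ) (β T : ℝ) : Prop where
  finite_energy : MemLp p 2 volume
  no_isi : ∀ n : ℤ, matchedResponse p (n * T) = if n = 0 then 1 else 0
  integrable_spectrum : Integrable G volume
  fourier_inversion : ∀ t : ℝ, (matchedResponse p t : ℂ) =
    ∫ f : ℝ, (G f : ℂ) * Complex.exp (2 * Real.pi * Complex.I * f * t)
  continuousOn_band : ContinuousOn G {f | |f| < (1 + β) / (2 * T)}
  pos_in_band : ∀ f, |f| < (1 + β) / (2 * T) → 0 < G f
  zero_off_band : ∀ f, (1 + β) / (2 * T) ≤ |f| → G f = 0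

/-- Square complex matrices of the block length `N = 2 M + 1`. -/
abbrev BlockMatrix (M : ℕ) := Matrix (Fin (2 * M + 1)) (Fin (2 * M + 1)) ℂ

/-- The block length `N = 2 M + 1` as a real number. -/
def blockLength (M : ℕ) : ℝ := 2 * M + 1

/-- The index `i ∈ {-M, …, M}` that belongs to a position `0, …, 2 M`. -/
def centred (M : ℕ) (n : Fin (2 * M + 1)) : ℤ := (n : ℤ) - M

/-- The Toeplitz matrix `(G)_{n,m} = g((n - m) δ T)` of the FTN channel `y = h G a + η`,
`η ∼ CN(0, σ² G)`. -/
def gram (p : ℝ → ℝ) (δ T : ℝ) (M : ℕ) : BlockMatrix M :=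
  Matrix.of fun n m => (matchedResponse p ((((n : ℕ) : ℝ) - ((m : ℕ) : ℝ)) * (δ * T)) : ℂ)

/-- The generating function of `gram`, that is, the folded spectrum
`(1 / (δ T)) ∑ₘ G((f - m) / (δ T))`. For a band-limited `G` the sum is finite. -/
def foldedSpectrum (G : ℝ → ℝ) (δ T f : ℝ) : ℝ :=
  (1 / (δ * T)) * ∑' m : ℤ, G ((f - m) / (δ * T))

/-- The unitary DFT matrix `D_{m,i} = N^{-1/2} exp(-2πj m i / N)`, with rows `m = 0, …, N - 1` and
columns `i = -M, …, M`. -/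
def dft (M : ℕ) : BlockMatrix M :=
  Matrix.of fun m n => ((1 / Real.sqrt (blockLength M) : ℝ) : ℂ) *
    Complex.exp (-(2 * Real.pi * Complex.I * ((m : ℕ) : ℂ) * (centred M n : ℂ) /
      (blockLength M : ℂ)))

/-- The matrix `D diag(d_{-M}, …, d_M) D†`. -/
def dftDiag (M : ℕ) (d : ℤ → ℝ) : BlockMatrix M :=
  dft M * Matrix.diagonal (fun n => (d (centred M n) : ℂ)) * (dft M).conjTranspose

/-- The large-block form `D Λ D†` of the matrix `gram`, where `Λ` holds the samples
`λ_i` of the generating function at `i / N`. -/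
def gramDFT (G : ℝ → ℝ) (δ T : ℝ) (M : ℕ) : BlockMatrix M :=
  dftDiag M fun i => foldedSpectrum G δ T (i / blockLength M)

/-- Information rate, in bits per symbol, of the channel `y = h A a + η`, `η ∼ CN(0, σ² A)`,
with circularly symmetric Gaussian input of covariance `S`:
`(1 / N) log₂ det (I + (|h|² / σ²) A S)`. -/
def infoRate {M : ℕ} (h : ℂ) (σ : ℝ) (A S : BlockMatrix M) : ℝ :=
  Real.logb 2 (1 + ((‖h‖ ^ 2 / σ ^ 2 : ℝ) : ℂ) • (A * S)).det.re / blockLength M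

/-- Mean instantaneous power `E |x(t)|²` of `x(t) = ∑_{m=-M}^{M} a[m] p(t - m δ T)` when the
symbols `a` have covariance `S`. -/
def meanPower (p : ℝ → ℝ) (δ T : ℝ) {M : ℕ} (S : BlockMatrix M) (t : ℝ) : ℝ :=
  (∑ m, ∑ n, (p (t - centred M m * (δ * T)) : ℂ) * S m n *
    (p (t - centred M n * (δ * T)) : ℂ)).re

/-- Mean energy per symbol, `(1 / N) ∫ E |x(t)|² dt`. -/
def symbolEnergy (p : ℝ → ℝ) (δ T : ℝ) {M : ℕ} (S : BlockMatrix M) : ℝ :=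
  (∫ t, meanPower p δ T S t) / blockLength M

/-- Mean energy per symbol `(1 / N) tr (S A)` when the Gram matrix of the shifted pulses is `A`. -/
def traceEnergy {M : ℕ} (A S : BlockMatrix M) : ℝ := (S * A).trace.re / blockLength M

/-- The received SNR `(E / T) / σ²` that belongs to the symbol energy `E`. -/
def snrRx (T σ E : ℝ) : ℝ := E / T / σ ^ 2

/-- `S` is an optimal covariance matrix at the SNR value `ρ`: it is a covariance matrix,
its SNR is `ρ`, and no covariance matrix of SNR at most `ρ` has a larger rate. -/
def IsOptimalCov {M : ℕ} (rate snr : BlockMatrix M → ℝ) (ρ : ℝ) (S : BlockMatrix M) : Prop :=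
  S.PosSemidef ∧ snr S = ρ ∧
    ∀ S' : BlockMatrix M, S'.PosSemidef → snr S' ≤ ρ → rate S' ≤ rate S

/-- The formula `P δ T G⁻¹` for moderate acceleration. -/
def covModerate {M : ℕ} (P δ T : ℝ) (A : BlockMatrix M) : BlockMatrix M :=
  ((P * δ * T : ℝ) : ℂ) • A⁻¹

open Classical in
/-- `Z`, the number of `i ∈ {-M, …, M}` with `G(i / (N δ T)) ≠ 0`. -/
def numNonzero (G : ℝ → ℝ) (δ T : ℝ) (M : ℕ) : ℕ :=
  ((Finset.Icc (-(M : ℤ)) M).filter fun i => G (i / (blockLength M * δ * T)) ≠ 0).card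

/-- The numbers `T / (G(i / (N δ T)) (1 + β))` for `|i| < Z / 2`, and `0` otherwise. -/
def lamTilde (G : ℝ → ℝ) (β δ T : ℝ) (M : ℕ) (i : ℤ) : ℝ :=
  if |(i : ℝ)| < (numNonzero G δ T M : ℝ) / 2 then
    T / (G (i / (blockLength M * δ * T)) * (1 + β))
  else 0

/-- The formula `P δ T D diag(λ̃_{-M}, …, λ̃_M) D†` for small acceleration. -/
def covSmall (G : ℝ → ℝ) (β P δ T : ℝ) (M : ℕ) : BlockMatrix M :=
  ((P * δ * T : ℝ) : ℂ) • dftDiag M (lamTilde G β δ T M)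

/-- The spectrum `φ` on `[-1/2, 1/2]` for small acceleration. -/
def phi (G : ℝ → ℝ) (β δ T f : ℝ) : ℝ :=
  if |f| < δ * (1 + β) / 2 then T / (G (f / (δ * T)) * (1 + β)) else 0

/-- Mean energy per symbol of a stationary input with power spectrum `s`. -/
def spectralEnergy (G : ℝ → ℝ) (δ T : ℝ) (s : ℝ → ℝ) : ℝ :=
  ∫ f in Set.Icc (-(1 / 2 : ℝ)) (1 / 2), s f * foldedSpectrum G δ T f

/-- Information rate, in bits per symbol, of a stationary Gaussian input with power spectrum `s`. -/
def spectralRate (G : ℝ → ℝ) (δ T : ℝ) (h : ℂ) (σ : ℝ) (s : ℝ → ℝ) : ℝ :=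
  ∫ f in Set.Icc (-(1 / 2 : ℝ)) (1 / 2),
    Real.logb 2 (1 + ‖h‖ ^ 2 / σ ^ 2 * (s f * foldedSpectrum G δ T f))

/-- `s` is an input power spectrum on `[-1/2, 1/2]` of finite energy. -/
structure IsInputSpectrum (G : ℝ → ℝ) (δ T : ℝ) (s : ℝ → ℝ) : Prop where
  measurable : Measurable s
  nonneg : ∀ f, 0 ≤ s f
  finite_energy :
    IntegrableOn (fun f => s f * foldedSpectrum G δ T f) (Set.Icc (-(1 / 2 : ℝ)) (1 / 2)) volume

/-- `s` is an optimal input power spectrum at the received SNR `ρ`. -/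
def IsOptimalSpectrum (G : ℝ → ℝ) (δ T : ℝ) (h : ℂ) (σ ρ : ℝ) (s : ℝ → ℝ) : Prop :=
  IsInputSpectrum G δ T s ∧ snrRx T σ (spectralEnergy G δ T s) = ρ ∧
    ∀ s' : ℝ → ℝ, IsInputSpectrum G δ T s' → snrRx T σ (spectralEnergy G δ T s') ≤ ρ →
      spectralRate G δ T h σ s' ≤ spectralRate G δ T h σ s

end FTN

end

noncomputable section

namespace FTN

/-! ### Concavity of log det, and inputs that the channel factor makes white. -/

section LinearAlgebra

open Matrix

/-! Optimality at fixed received energy is simple because rate and energy see the input only through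
one matrix. Write the channel matrix as `A = Cᴴ * C`. By Sylvester's identity the rate is the
normalised log det of `1 + c B` with `B = C S Cᴴ`, and the energy is the normalised trace of the
same `B`. The tangent line of `log (1 + c x)` at `x = e`, applied to every eigenvalue of `B`, bounds
the rate by an affine function of the energy, with equality only for `B = e`. So an input with `C S
Cᴴ = e` is optimal at its own energy (`infoRate_le_tangent`, `white_of_tangent_eq`).

For moderate acceleration `A` is positive definite, `C` is invertible, and whiteness means exactly
`S = E A⁻¹`. For the Toeplitz matrix, definiteness holds because its quadratic form integrates `G`
against the squared modulus of a trigonometric polynomial.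

For small acceleration the replicas in the folded spectrum are disjoint, and `φ` inverts the only
one inside the unit period. The DFT form is then singular, so `C` keeps just the nonzero rows of
`Λ^{1/2} D†`; sampling `φ` whitens the input at the level `E / (δ (1 + β))`. The energy of the
sampled input is a Riemann sum, which only tends to `E`; the tangent slope, independent of the block
length, converts this defect into a vanishing rate loss. Stationary spectra obey the same tangent
argument under the integral (`integral_logb_le`).

Asymptotic equivalence is weak convergence plus convergence of norms. The diagonals of the circulant
matrix are Riemann sums of the Fourier coefficients of the folded spectrum, its Frobenius norm is a
Riemann sum of the squared `L²` norm, and Parseval matches the limits (`tendsto_toeplitz_sub`). This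
needs `G` to be bounded, which is derived from the absence of intersymbol interference
(`IsPulse.le_period`). -/

theorem log_one_add_mul_lt {c e x : ℝ} (hc : 0 < c) (he : 0 ≤ e) (hx : 0 ≤ x) (hne : x ≠ e) :
    Real.log (1 + c * x) < Real.log (1 + c * e) + c / (1 + c * e) * (x - e) := by
  have h1 : 0 < 1 + c * e := by positivity
  have h2 : 0 < 1 + c * x := by positivity
  have h3 : (1 + c * x) / (1 + c * e) ≠ 1 := by
    rw [Ne, div_eq_one_iff_eq h1.ne']
    intro h
    exact hne (mul_left_cancel₀ hc.ne' (add_left_cancel h))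
  have h4 := Real.log_lt_sub_one_of_pos (div_pos h2 h1) h3
  rw [Real.log_div h2.ne' h1.ne'] at h4
  have h5 : (1 + c * x) / (1 + c * e) - 1 = c / (1 + c * e) * (x - e) := by
    field_simp
    ring
  linarith

theorem log_one_add_mul_le {c e x : ℝ} (hc : 0 < c) (he : 0 ≤ e) (hx : 0 ≤ x) :
    Real.log (1 + c * x) ≤ Real.log (1 + c * e) + c / (1 + c * e) * (x - e) := by
  rcases eq_or_ne x e with rfl | hne
  · simp
  · exact (log_one_add_mul_lt hc he hx hne).le

variable {r : Type*} [Fintype r] [DecidableEq r]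

theorem _root_.Matrix.IsHermitian.det_one_add_smul {B : Matrix r r ℂ} (hB : B.IsHermitian)
    (c : ℝ) : (1 + (c : ℂ) • B).det = ((∏ i, (1 + c * hB.eigenvalues i) : ℝ) : ℂ) := by
  have hU : (hB.eigenvectorUnitary : Matrix r r ℂ) * star (hB.eigenvectorUnitary : Matrix r r ℂ)
      = 1 := Unitary.coe_mul_star_self _
  have key : 1 + (c : ℂ) • B = (hB.eigenvectorUnitary : Matrix r r ℂ) *
      diagonal (fun i => ((1 + c * hB.eigenvalues i : ℝ) : ℂ)) *
        star (hB.eigenvectorUnitary : Matrix r r ℂ) := by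
    have hd : diagonal (fun i => ((1 + c * hB.eigenvalues i : ℝ) : ℂ)) =
        1 + (c : ℂ) • diagonal (RCLike.ofReal ∘ hB.eigenvalues : r → ℂ) := by
      ext i j
      rcases eq_or_ne i j with rfl | hij
      · simp
      · simp [hij]
    conv_lhs => rw [hB.spectral_theorem, Unitary.conjStarAlgAut_apply]
    rw [hd, mul_add, add_mul, mul_one, hU]
    simp
  have h1 := congrArg det hU
  rw [det_mul, det_one] at h1
  rw [key, det_mul, det_mul, mul_right_comm, h1, det_diagonal]
  simp

theorem _root_.Matrix.IsHermitian.eq_smul_one {B : Matrix r r ℂ} (hB : B.IsHermitian) {e : ℝ}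
    (h : ∀ i, hB.eigenvalues i = e) : B = (e : ℂ) • (1 : Matrix r r ℂ) := by
  have hU : (hB.eigenvectorUnitary : Matrix r r ℂ) * star (hB.eigenvectorUnitary : Matrix r r ℂ)
      = 1 := Unitary.coe_mul_star_self _
  have hd : diagonal (RCLike.ofReal ∘ hB.eigenvalues : r → ℂ) = (e : ℂ) • (1 : Matrix r r ℂ) := by
    ext i j
    rcases eq_or_ne i j with rfl | hij
    · simp [h]
    · simp [hij]
  conv_lhs => rw [hB.spectral_theorem, Unitary.conjStarAlgAut_apply, hd]
  rw [mul_smul_comm, mul_one, smul_mul_assoc, hU]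

theorem _root_.Matrix.PosSemidef.log_det_eq_sum {B : Matrix r r ℂ} (hB : B.PosSemidef) {c : ℝ}
    (hc : 0 < c) : Real.log (1 + (c : ℂ) • B).det.re =
      ∑ i, Real.log (1 + c * hB.1.eigenvalues i) := by
  rw [hB.1.det_one_add_smul, Complex.ofReal_re, Real.log_prod]
  intro i _
  have := hB.eigenvalues_nonneg i
  positivity

theorem _root_.Matrix.IsHermitian.trace_re {B : Matrix r r ℂ} (hB : B.IsHermitian) :
    B.trace.re = ∑ i, hB.eigenvalues i := by
  simp [hB.trace_eq_sum_eigenvalues]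

/-- The tangent inequality of the concave function `B ↦ log det (1 + c B)` at `B = e`. -/
theorem _root_.Matrix.PosSemidef.log_det_le {B : Matrix r r ℂ} (hB : B.PosSemidef) {c e : ℝ}
    (hc : 0 < c) (he : 0 ≤ e) : Real.log (1 + (c : ℂ) • B).det.re ≤
      Fintype.card r * Real.log (1 + c * e) +
        c / (1 + c * e) * (B.trace.re - Fintype.card r * e) := by
  rw [hB.log_det_eq_sum hc, hB.1.trace_re]
  refine (Finset.sum_le_sum fun i _ => log_one_add_mul_le hc he (hB.eigenvalues_nonneg i)).trans
    (le_of_eq ?_)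
  simp only [Finset.sum_add_distrib, ← Finset.mul_sum, Finset.sum_sub_distrib, Finset.sum_const,
    Finset.card_univ, nsmul_eq_mul]

/-- The scalar tangent inequality is strict at every eigenvalue other than `e`, so equality leaves
only the eigenvalue `e`, and a Hermitian matrix with a single eigenvalue is scalar. -/
theorem _root_.Matrix.PosSemidef.eq_smul_one_of_log_det_eq {B : Matrix r r ℂ} (hB : B.PosSemidef)
    {c e : ℝ} (hc : 0 < c) (he : 0 ≤ e) (h : Fintype.card r * Real.log (1 + c * e) +
        c / (1 + c * e) * (B.trace.re - Fintype.card r * e) ≤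
          Real.log (1 + (c : ℂ) • B).det.re) : B = (e : ℂ) • (1 : Matrix r r ℂ) := by
  refine hB.1.eq_smul_one fun i => ?_
  by_contra hne
  refine h.not_gt ?_
  rw [hB.log_det_eq_sum hc, hB.1.trace_re]
  refine (Finset.sum_lt_sum
    (fun i _ => log_one_add_mul_le hc he (hB.eigenvalues_nonneg i))
    ⟨i, Finset.mem_univ i, log_one_add_mul_lt hc he (hB.eigenvalues_nonneg i) hne⟩).trans_eq ?_
  simp only [Finset.sum_add_distrib, ← Finset.mul_sum, Finset.sum_sub_distrib, Finset.sum_const,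
    Finset.card_univ, nsmul_eq_mul]

theorem _root_.Matrix.det_one_add_smul_smul_one (c e : ℝ) :
    (1 + (c : ℂ) • ((e : ℂ) • (1 : Matrix r r ℂ))).det = (((1 + c * e) ^ Fintype.card r : ℝ) : ℂ) := by
  have : 1 + (c : ℂ) • ((e : ℂ) • (1 : Matrix r r ℂ)) =
      diagonal fun _ : r => ((1 + c * e : ℝ) : ℂ) := by
    ext i j
    rcases eq_or_ne i j with rfl | hij
    · simp
    · simp [hij]
  rw [this, det_diagonal]
  simp

theorem blockLength_pos (M : ℕ) : 0 < blockLength M := by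
  unfold blockLength; positivity

variable {M : ℕ} {h : ℂ} {σ : ℝ}

/-- Sylvester's identity replaces the non-Hermitian product `A S` by the positive semidefinite `C S
Cᴴ`. The index type `r` may be smaller than the block, which is how singular channels are covered.
-/
theorem infoRate_factor (C : Matrix r (Fin (2 * M + 1)) ℂ) (S : BlockMatrix M) :
    infoRate h σ (Cᴴ * C) S =
      Real.log (1 + ((‖h‖ ^ 2 / σ ^ 2 : ℝ) : ℂ) • (C * S * Cᴴ)).det.re / Real.log 2 /
        blockLength M := by
  unfold infoRate
  rw [Real.logb]
  have : 1 + ((‖h‖ ^ 2 / σ ^ 2 : ℝ) : ℂ) • (Cᴴ * C * S) =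
      1 + Cᴴ * (((‖h‖ ^ 2 / σ ^ 2 : ℝ) : ℂ) • (C * S)) := by
    rw [Matrix.mul_assoc, Matrix.mul_smul]
  rw [this, det_one_add_mul_comm, Matrix.smul_mul]

theorem traceEnergy_factor {r : Type*} [Fintype r] (C : Matrix r (Fin (2 * M + 1)) ℂ) (S : BlockMatrix M) :
    traceEnergy (Cᴴ * C) S = (C * S * Cᴴ).trace.re / blockLength M := by
  unfold traceEnergy
  rw [← Matrix.mul_assoc, Matrix.trace_mul_comm, ← Matrix.mul_assoc]

/-- Rate and symbol energy of an input that becomes white after the factor `C` of the channel. -/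
theorem infoRate_of_white {C : Matrix r (Fin (2 * M + 1)) ℂ} {S : BlockMatrix M} {e : ℝ}
    (hS : C * S * Cᴴ = (e : ℂ) • (1 : Matrix r r ℂ)) :
    infoRate h σ (Cᴴ * C) S =
      Fintype.card r * Real.log (1 + ‖h‖ ^ 2 / σ ^ 2 * e) / Real.log 2 / blockLength M := by
  rw [infoRate_factor, hS, det_one_add_smul_smul_one, Complex.ofReal_re, Real.log_pow]

theorem traceEnergy_of_white {C : Matrix r (Fin (2 * M + 1)) ℂ} {S : BlockMatrix M} {e : ℝ}
    (hS : C * S * Cᴴ = (e : ℂ) • (1 : Matrix r r ℂ)) :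
    traceEnergy (Cᴴ * C) S = Fintype.card r * e / blockLength M := by
  rw [traceEnergy_factor, hS]
  simp [mul_comm]

/-- The energy difference stays in the bound: for small acceleration it measures how far an input
with slightly more energy than `S₀` can exceed its rate. -/
theorem infoRate_le_tangent (hh : h ≠ 0) (hσ : 0 < σ) {C : Matrix r (Fin (2 * M + 1)) ℂ}
    {S₀ S : BlockMatrix M} {e : ℝ} (he : 0 ≤ e)
    (hS₀ : C * S₀ * Cᴴ = (e : ℂ) • (1 : Matrix r r ℂ)) (hS : S.PosSemidef) :
    infoRate h σ (Cᴴ * C) S ≤ infoRate h σ (Cᴴ * C) S₀ +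
      ‖h‖ ^ 2 / σ ^ 2 / (1 + ‖h‖ ^ 2 / σ ^ 2 * e) / Real.log 2 *
        (traceEnergy (Cᴴ * C) S - traceEnergy (Cᴴ * C) S₀) := by
  have hc : 0 < ‖h‖ ^ 2 / σ ^ 2 := by positivity
  have hl := Real.log_pos one_lt_two
  have hN := blockLength_pos M
  have h1 := (hS.mul_mul_conjTranspose_same C).log_det_le hc he
  rw [infoRate_of_white hS₀, traceEnergy_of_white hS₀, infoRate_factor, traceEnergy_factor]
  have h2 := div_le_div_of_nonneg_right (div_le_div_of_nonneg_right h1 hl.le) hN.le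
  refine h2.trans (le_of_eq ?_)
  ring

theorem white_of_tangent_eq (hh : h ≠ 0) (hσ : 0 < σ) {C : Matrix r (Fin (2 * M + 1)) ℂ}
    {S₀ S : BlockMatrix M} {e : ℝ} (he : 0 ≤ e)
    (hS₀ : C * S₀ * Cᴴ = (e : ℂ) • (1 : Matrix r r ℂ)) (hS : S.PosSemidef)
    (hE : traceEnergy (Cᴴ * C) S = traceEnergy (Cᴴ * C) S₀)
    (hR : infoRate h σ (Cᴴ * C) S₀ ≤ infoRate h σ (Cᴴ * C) S) :
    C * S * Cᴴ = (e : ℂ) • (1 : Matrix r r ℂ) := by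
  have hc : 0 < ‖h‖ ^ 2 / σ ^ 2 := by positivity
  have hl := Real.log_pos one_lt_two
  have hN := blockLength_pos M
  refine (hS.mul_mul_conjTranspose_same C).eq_smul_one_of_log_det_eq hc he ?_
  rw [traceEnergy_of_white hS₀, traceEnergy_factor, div_left_inj' hN.ne'] at hE
  rw [infoRate_of_white hS₀, infoRate_factor, div_le_div_iff_of_pos_right hN,
    div_le_div_iff_of_pos_right hl] at hR
  rw [hE]
  simpa using hR

theorem snrRx_le_iff {T σ a b : ℝ} (hT : 0 < T) (hσ : 0 < σ) :
    snrRx T σ a ≤ snrRx T σ b ↔ a ≤ b := by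
  unfold snrRx
  rw [div_le_div_iff_of_pos_right (by positivity), div_le_div_iff_of_pos_right hT]

theorem snrRx_inj {T σ a b : ℝ} (hT : 0 < T) (hσ : 0 < σ) :
    snrRx T σ a = snrRx T σ b ↔ a = b := by
  simp only [le_antisymm_iff, snrRx_le_iff hT hσ]

/-- An input that becomes white after the factor `C` of the channel is optimal. -/
theorem isOptimalCov_of_white {T : ℝ} (hT : 0 < T) (hh : h ≠ 0) (hσ : 0 < σ)
    {C : Matrix r (Fin (2 * M + 1)) ℂ} {S₀ : BlockMatrix M} {e : ℝ} (he : 0 ≤ e)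
    (hS₀ : C * S₀ * Cᴴ = (e : ℂ) • (1 : Matrix r r ℂ)) (hpos : S₀.PosSemidef) :
    IsOptimalCov (infoRate h σ (Cᴴ * C)) (fun S => snrRx T σ (traceEnergy (Cᴴ * C) S))
      (snrRx T σ (traceEnergy (Cᴴ * C) S₀)) S₀ := by
  refine ⟨hpos, rfl, fun S hS hle => ?_⟩
  have hc : 0 < ‖h‖ ^ 2 / σ ^ 2 := by positivity
  have hl := Real.log_pos one_lt_two
  have hle' := (snrRx_le_iff hT hσ).1 hle
  refine (infoRate_le_tangent hh hσ he hS₀ hS).trans ?_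
  have : ‖h‖ ^ 2 / σ ^ 2 / (1 + ‖h‖ ^ 2 / σ ^ 2 * e) / Real.log 2 *
      (traceEnergy (Cᴴ * C) S - traceEnergy (Cᴴ * C) S₀) ≤ 0 :=
    mul_nonpos_of_nonneg_of_nonpos (by positivity) (by linarith)
  linarith

theorem IsOptimalCov.white {T : ℝ} (hT : 0 < T) (hh : h ≠ 0) (hσ : 0 < σ)
    {C : Matrix r (Fin (2 * M + 1)) ℂ} {S₀ S : BlockMatrix M} {e : ℝ} (he : 0 ≤ e)
    (hS₀ : C * S₀ * Cᴴ = (e : ℂ) • (1 : Matrix r r ℂ)) (hpos : S₀.PosSemidef)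
    (hS : IsOptimalCov (infoRate h σ (Cᴴ * C)) (fun S => snrRx T σ (traceEnergy (Cᴴ * C) S))
      (snrRx T σ (traceEnergy (Cᴴ * C) S₀)) S) :
    C * S * Cᴴ = (e : ℂ) • (1 : Matrix r r ℂ) :=
  white_of_tangent_eq hh hσ he hS₀ hS.1 ((snrRx_inj hT hσ).1 hS.2.1) (hS.2.2 S₀ hpos le_rfl)

theorem _root_.Matrix.PosDef.exists_eq_conjTranspose_mul_self {A : Matrix r r ℂ} (hA : A.PosDef) :
    ∃ C : Matrix r r ℂ, A = Cᴴ * C ∧ IsUnit C := by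
  open scoped MatrixOrder Matrix.Norms.L2Operator in
  obtain ⟨C, hC⟩ := CStarAlgebra.nonneg_iff_eq_star_mul_self.1 hA.posSemidef.nonneg
  refine ⟨C, hC, ?_⟩
  have := hA.isUnit
  rw [Matrix.isUnit_iff_isUnit_det] at this ⊢
  rw [hC, det_mul] at this
  exact isUnit_of_mul_isUnit_right this

/-- For a positive definite channel matrix the optimum is attained by the scaled inverse only. -/
theorem isOptimalCov_iff_of_posDef {δ T E : ℝ} (hδ : 0 < δ) (hT : 0 < T) (hE : 0 < E)
    (hh : h ≠ 0) (hσ : 0 < σ) {A : BlockMatrix M} (hA : A.PosDef) (S : BlockMatrix M) :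
    IsOptimalCov (infoRate h σ A) (fun S' => snrRx T σ (traceEnergy A S')) (snrRx T σ E) S ↔
      S = covModerate (E / (δ * T)) δ T A := by
  obtain ⟨C, rfl, hC⟩ := hA.exists_eq_conjTranspose_mul_self
  have hCH : IsUnit Cᴴ := (Matrix.isUnit_conjTranspose (A := C)).2 hC
  have hcoef : E / (δ * T) * δ * T = E := by field_simp
  have hCd := (Matrix.isUnit_iff_isUnit_det _).1 hC
  have hCHd := (Matrix.isUnit_iff_isUnit_det _).1 hCH
  have hcov : covModerate (E / (δ * T)) δ T (Cᴴ * C) = (E : ℂ) • (C⁻¹ * Cᴴ⁻¹) := by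
    unfold covModerate
    rw [hcoef, Matrix.mul_inv_rev]
  have hwhite : C * covModerate (E / (δ * T)) δ T (Cᴴ * C) * Cᴴ =
      (E : ℂ) • (1 : Matrix (Fin (2 * M + 1)) (Fin (2 * M + 1)) ℂ) := by
    rw [hcov, Matrix.mul_smul, Matrix.smul_mul, ← Matrix.mul_assoc, Matrix.mul_nonsing_inv _ hCd,
      Matrix.one_mul, Matrix.nonsing_inv_mul _ hCHd]
  have hpos : (covModerate (E / (δ * T)) δ T (Cᴴ * C)).PosSemidef := by
    unfold covModerate
    rw [hcoef]
    exact hA.inv.posSemidef.smul (by exact_mod_cast hE.le)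
  have hen : traceEnergy (Cᴴ * C) (covModerate (E / (δ * T)) δ T (Cᴴ * C)) = E := by
    rw [traceEnergy_of_white hwhite]
    have : (Fintype.card (Fin (2 * M + 1)) : ℝ) = blockLength M := by
      simp [blockLength]
    rw [this, mul_div_cancel_left₀ _ (blockLength_pos M).ne']
  constructor
  · intro hS
    rw [← hen] at hS
    have := hS.white hT hh hσ hE.le hwhite hpos
    rw [hcov]
    have h2 := congrArg (fun X => C⁻¹ * X * Cᴴ⁻¹) this
    rw [Matrix.mul_smul, Matrix.smul_mul, Matrix.mul_one, ← Matrix.mul_assoc, ← Matrix.mul_assoc,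
      Matrix.nonsing_inv_mul _ hCd, Matrix.one_mul, Matrix.mul_assoc,
      Matrix.mul_nonsing_inv _ hCHd, Matrix.mul_one] at h2
    exact h2
  · rintro rfl
    have := isOptimalCov_of_white hT hh hσ hE.le hwhite hpos
    rwa [hen] at this

end LinearAlgebra

/-! ### Transmitted energy and positive definiteness of the Toeplitz matrix. -/

section Gram

open Matrix

variable {p G : ℝ → ℝ} {β T δ : ℝ}

theorem integral_shift_mul_shift (p : ℝ → ℝ) (a b : ℝ) :
    ∫ t, p (t - a) * p (t - b) = matchedResponse p (b - a) := by
  rw [matchedResponse, ← integral_sub_right_eq_self (fun s => p s * p (s - (b - a))) a]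
  congr 1
  ext t
  ring_nf

theorem matchedResponse_neg (p : ℝ → ℝ) (t : ℝ) :
    matchedResponse p (-t) = matchedResponse p t := by
  have h1 := integral_shift_mul_shift p t 0
  have h2 := integral_shift_mul_shift p 0 t
  simp only [mul_comm (p (_ - t))] at h1
  rw [h2] at h1
  simpa using h1.symm

theorem integrable_shift_mul_shift (hp : MemLp p 2 volume) (a b : ℝ) :
    Integrable fun t => p (t - a) * p (t - b) :=
  (hp.comp_measurePreserving (measurePreserving_sub_right volume a)).integrable_mul
    (hp.comp_measurePreserving (measurePreserving_sub_right volume b))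

/-- The cross products of shifted pulses integrate to `g` at differences of shifts. Only differences
matter, so the centred indices of the waveform fit the positions `0, …, 2 M` of `gram`. -/
theorem symbolEnergy_eq_traceEnergy (hp : MemLp p 2 volume) (δ T : ℝ) {M : ℕ}
    (S : BlockMatrix M) : symbolEnergy p δ T S = traceEnergy (gram p δ T M) S := by
  unfold symbolEnergy traceEnergy meanPower
  congr 1
  have hint : ∀ m n, Integrable fun t : ℝ => (p (t - centred M m * (δ * T)) : ℂ) * S m n *
      (p (t - centred M n * (δ * T)) : ℂ) := by
    intro m n
    refine (((integrable_shift_mul_shift hp (centred M m * (δ * T))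
      (centred M n * (δ * T))).ofReal (𝕜 := ℂ)).const_mul (S m n)).congr (.of_forall fun t => ?_)
    simp only [RCLike.ofReal_mul, Complex.coe_algebraMap]
    ring
  have hint2 : Integrable fun t : ℝ => ∑ m, ∑ n, (p (t - centred M m * (δ * T)) : ℂ) * S m n *
      (p (t - centred M n * (δ * T)) : ℂ) :=
    integrable_finsetSum _ fun m _ => integrable_finsetSum _ fun n _ => hint m n
  have := integral_re (𝕜 := ℂ) hint2
  simp only [RCLike.re_eq_complex_re] at this
  rw [this, integral_finsetSum _ fun m _ => integrable_finsetSum _ fun n _ => hint m n]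
  congr 1
  rw [Matrix.trace]
  refine Finset.sum_congr rfl fun m _ => ?_
  rw [integral_finsetSum _ fun n _ => hint m n, Matrix.diag_apply, Matrix.mul_apply]
  refine Finset.sum_congr rfl fun n _ => ?_
  have h1 : ∀ t : ℝ, (p (t - centred M m * (δ * T)) : ℂ) * S m n *
      (p (t - centred M n * (δ * T)) : ℂ) = S m n *
        ((p (t - centred M m * (δ * T)) * p (t - centred M n * (δ * T)) : ℝ) : ℂ) := by
    intro t; push_cast; ring
  simp only [h1]
  rw [integral_const_mul, integral_complex_ofReal, integral_shift_mul_shift]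
  congr 3
  simp only [centred]
  push_cast
  ring_nf

theorem gram_isHermitian (p : ℝ → ℝ) (δ T : ℝ) (M : ℕ) : (gram p δ T M).IsHermitian := by
  ext n m
  simp only [gram, conjTranspose_apply, of_apply, RCLike.star_def, Complex.conj_ofReal]
  rw [← matchedResponse_neg]
  ring_nf

theorem IsPulse.nonneg (hp : IsPulse p G β T) (f : ℝ) : 0 ≤ G f := by
  rcases lt_or_ge |f| ((1 + β) / (2 * T)) with h | h
  · exact (hp.pos_in_band f h).le
  · exact (hp.zero_off_band f h).ge

/-- The trigonometric polynomial `∑ xₘ exp(-2πj m u)`. -/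
def trigSum {n : ℕ} (x : Fin n → ℂ) (u : ℝ) : ℂ :=
  ∑ m, x m * Complex.exp (-(2 * Real.pi * Complex.I * u)) ^ (m : ℕ)

theorem continuous_trigSum {n : ℕ} (x : Fin n → ℂ) : Continuous (trigSum x) := by
  unfold trigSum
  fun_prop

theorem exp_two_pi_injOn : Set.InjOn (fun u : ℝ => Complex.exp (-(2 * Real.pi * Complex.I * u)))
    (Set.Ioo 0 (1 / 2)) := by
  intro u hu v hv huv
  obtain ⟨n, hn⟩ := Complex.exp_eq_exp_iff_exists_int.1 huv
  have h0 : (2 * Real.pi * Complex.I : ℂ) ≠ 0 := Complex.two_pi_I_ne_zero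
  have h1 : (u : ℂ) = v - n := by
    apply mul_left_cancel₀ h0
    linear_combination -hn
  have h2 : u = v - n := by exact_mod_cast h1
  have h3 : ((n : ℤ) : ℝ) < 1 := by linarith [hu.1, hv.2]
  have h4 : (-1 : ℝ) < n := by linarith [hv.1, hu.2]
  have h5 : n = 0 := by
    have : n < 1 := by exact_mod_cast h3
    have : -1 < n := by exact_mod_cast h4
    omega
  simpa [h5] using h2

/-- In `z = exp(-2πj u)` the sum is an ordinary polynomial, and `u ↦ z` is injective on a short
interval; vanishing near `0` would give infinitely many roots. -/
theorem exists_trigSum_ne_zero {n : ℕ} {x : Fin n → ℂ} (hx : x ≠ 0) {a : ℝ} (ha : 0 < a) :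
    ∃ u, |u| < a ∧ trigSum x u ≠ 0 := by
  by_contra! hcon
  apply hx
  let P : Polynomial ℂ := ∑ m : Fin n, Polynomial.C (x m) * Polynomial.X ^ (m : ℕ)
  have hP : P = 0 := by
    apply Polynomial.eq_zero_of_infinite_isRoot
    have hinf : (Set.Ioo (0 : ℝ) (min a (1 / 2))).Infinite :=
      Set.Ioo_infinite (by positivity)
    refine (hinf.image (exp_two_pi_injOn.mono
      (Set.Ioo_subset_Ioo_right (min_le_right _ _)))).mono ?_
    rintro _ ⟨u, hu, rfl⟩
    have := hcon u (by rw [abs_of_pos hu.1]; exact hu.2.trans_le (min_le_left _ _))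
    simpa [P, Polynomial.IsRoot, Polynomial.eval_finsetSum, trigSum] using this
  ext m
  have h1 : P.coeff m = 0 := by rw [hP, Polynomial.coeff_zero]
  simp only [P, Polynomial.finsetSum_coeff, Polynomial.coeff_C_mul_X_pow] at h1
  rw [Finset.sum_eq_single m] at h1
  · simpa using h1
  · intro b _ hb
    rw [if_neg]
    exact fun h => hb (Fin.ext h.symm)
  · simp

/-- Fourier inversion turns each entry into an integral of an exponential in `n - m`, and the double
sum under the integral factors into a squared modulus. -/
theorem star_dotProduct_gram_mulVec (hp : IsPulse p G β T) (δ : ℝ) {M : ℕ}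
    (x : Fin (2 * M + 1) → ℂ) : star x ⬝ᵥ (gram p δ T M *ᵥ x) =
      ((∫ f, G f * ‖trigSum x (f * (δ * T))‖ ^ 2 : ℝ) : ℂ) := by
  have hint : ∀ n m : Fin (2 * M + 1), Integrable fun f : ℝ => star (x n) * x m *
      ((G f : ℂ) * Complex.exp (2 * Real.pi * Complex.I * f *
        (((((n : ℕ) : ℝ) - ((m : ℕ) : ℝ)) * (δ * T) : ℝ) : ℂ))) := by
    intro n m
    refine ((hp.integrable_spectrum.ofReal (𝕜 := ℂ)).mul_bdd (c := 1) ?_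
      (.of_forall fun f => ?_)).const_mul _
    · exact Continuous.aestronglyMeasurable (by fun_prop)
    · refine le_of_eq ?_
      rw [Complex.norm_exp]
      simp
  calc star x ⬝ᵥ (gram p δ T M *ᵥ x)
      = ∑ n, ∑ m, ∫ f : ℝ, star (x n) * x m *
      ((G f : ℂ) * Complex.exp (2 * Real.pi * Complex.I * f *
        (((((n : ℕ) : ℝ) - ((m : ℕ) : ℝ)) * (δ * T) : ℝ) : ℂ))) := by
        simp only [dotProduct, mulVec, gram, of_apply, Finset.mul_sum]
        refine Finset.sum_congr rfl fun n _ => Finset.sum_congr rfl fun m _ => ?_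
        rw [integral_const_mul, hp.fourier_inversion]
        simp only [Pi.star_apply]
        ring
    _ = ∫ f : ℝ, ∑ n, ∑ m, star (x n) * x m *
      ((G f : ℂ) * Complex.exp (2 * Real.pi * Complex.I * f *
        (((((n : ℕ) : ℝ) - ((m : ℕ) : ℝ)) * (δ * T) : ℝ) : ℂ))) := by
        rw [integral_finsetSum _ fun n _ => integrable_finsetSum _ fun m _ => hint n m]
        refine Finset.sum_congr rfl fun n _ => ?_
        rw [integral_finsetSum _ fun m _ => hint n m]
    _ = ∫ f : ℝ, ((G f * ‖trigSum x (f * (δ * T))‖ ^ 2 : ℝ) : ℂ) := by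
        congr 1
        ext f
        have h1 : ((‖trigSum x (f * (δ * T))‖ ^ 2 : ℝ) : ℂ) =
            star (trigSum x (f * (δ * T))) * trigSum x (f * (δ * T)) := by
          rw [Complex.ofReal_pow, ← Complex.conj_mul', RCLike.star_def]
        rw [Complex.ofReal_mul, h1]
        unfold trigSum
        rw [star_sum, Finset.sum_mul_sum, Finset.mul_sum]
        refine Finset.sum_congr rfl fun n _ => ?_
        rw [Finset.mul_sum]
        refine Finset.sum_congr rfl fun m _ => ?_
        have h2 : star (Complex.exp (-(2 * Real.pi * Complex.I * (f * (δ * T) : ℝ))) ^ (n : ℕ)) *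
            Complex.exp (-(2 * Real.pi * Complex.I * (f * (δ * T) : ℝ))) ^ (m : ℕ) =
            Complex.exp (2 * Real.pi * Complex.I * f *
              (((((n : ℕ) : ℝ) - ((m : ℕ) : ℝ)) * (δ * T) : ℝ) : ℂ)) := by
          rw [star_pow, RCLike.star_def, ← Complex.exp_conj, ← Complex.exp_nat_mul,
            ← Complex.exp_nat_mul, ← Complex.exp_add]
          congr 1
          simp only [map_neg, map_mul, Complex.conj_I, Complex.conj_ofReal, map_ofNat]
          push_cast
          ring
        rw [← h2, star_mul']
        ring
    _ = _ := integral_complex_ofReal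

/-- No lower bound on `δ` is needed: however narrow the scaled band is, a nonzero trigonometric
polynomial is nonzero on a nonempty open part of it. Only the DFT form can become singular. -/
theorem gram_posDef (hβ : 0 ≤ β) (hT : 0 < T) (hδ : 0 < δ) (hp : IsPulse p G β T) (M : ℕ) :
    (gram p δ T M).PosDef := by
  refine .of_dotProduct_mulVec_pos (gram_isHermitian p δ T M) fun x hx => ?_
  rw [star_dotProduct_gram_mulVec hp]
  rw [Complex.zero_lt_real]
  have hcont : Continuous fun f : ℝ => trigSum x (f * (δ * T)) :=
    (continuous_trigSum x).comp (by fun_prop)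
  have hint : Integrable fun f => G f * ‖trigSum x (f * (δ * T))‖ ^ 2 := by
    refine hp.integrable_spectrum.mul_bdd (c := (∑ m, ‖x m‖) ^ 2) ?_ (.of_forall fun f => ?_)
    · exact Continuous.aestronglyMeasurable (by fun_prop)
    · rw [norm_pow, norm_norm]
      gcongr
      unfold trigSum
      refine (norm_sum_le _ _).trans (Finset.sum_le_sum fun m _ => ?_)
      rw [norm_mul, norm_pow, Complex.norm_exp]
      simp
  rw [integral_pos_iff_support_of_nonneg (fun f => mul_nonneg (hp.nonneg f) (by positivity)) hint]
  have hband : 0 < (1 + β) / (2 * T) := by positivity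
  obtain ⟨u, hu, hne⟩ := exists_trigSum_ne_zero hx
    (show 0 < (1 + β) / (2 * T) * (δ * T) by positivity)
  have hsub : {f : ℝ | |f| < (1 + β) / (2 * T)} ∩ {f : ℝ | trigSum x (f * (δ * T)) ≠ 0} ⊆
      Function.support fun f => G f * ‖trigSum x (f * (δ * T))‖ ^ 2 := by
    rintro f ⟨h1, h2⟩
    exact mul_ne_zero (hp.pos_in_band f h1).ne' (pow_ne_zero 2 (norm_ne_zero_iff.2 h2))
  refine lt_of_lt_of_le (IsOpen.measure_pos volume ?_ ?_) (measure_mono hsub)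
  · exact (isOpen_lt continuous_abs continuous_const).inter (isOpen_ne_fun hcont continuous_const)
  · have hd : 0 < δ * T := by positivity
    refine ⟨u / (δ * T), ?_, ?_⟩
    · simp only [Set.mem_ofPred_eq]
      rw [abs_div, abs_of_pos hd, div_lt_iff₀ hd]
      exact hu
    · simp only [Set.mem_ofPred_eq]
      rwa [div_mul_cancel₀ _ hd.ne']

end Gram

/-! ### The Nyquist criterion as an identity of measures, and the bound on `G`. -/

section Pulse

variable {p G : ℝ → ℝ} {β T δ : ℝ}

theorem isOpen_band (b : ℝ) : IsOpen {f : ℝ | |f| < b} :=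
  isOpen_lt continuous_abs continuous_const

theorem IsPulse.measurable (hp : IsPulse p G β T) : Measurable G := by
  classical
  have h : G = Set.piecewise {f : ℝ | |f| < (1 + β) / (2 * T)} G 0 := by
    ext f
    by_cases hf : f ∈ {f : ℝ | |f| < (1 + β) / (2 * T)}
    · rw [Set.piecewise_eq_of_mem _ _ _ hf]
    · rw [Set.piecewise_eq_of_notMem _ _ _ hf]
      exact hp.zero_off_band f (not_lt.1 hf)
  rw [h]
  exact hp.continuousOn_band.measurable_piecewise continuousOn_const (isOpen_band _).measurableSet

/-- The energy spectrum of a pulse, as a measure. -/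
def spectralMeasure (G : ℝ → ℝ) : Measure ℝ := volume.withDensity fun f => ENNReal.ofReal (G f)

theorem IsPulse.isFiniteMeasure (hp : IsPulse p G β T) :
    IsFiniteMeasure (spectralMeasure G) :=
  isFiniteMeasure_withDensity_ofReal hp.integrable_spectrum.2

theorem IsPulse.integral_spectralMeasure (hp : IsPulse p G β T) (φ : ℝ → ℂ) :
    ∫ f, φ f ∂spectralMeasure G = ∫ f, (G f : ℂ) * φ f := by
  rw [spectralMeasure, integral_withDensity_eq_integral_toReal_smul₀
    hp.measurable.ennreal_ofReal.aemeasurable (.of_forall fun _ => ENNReal.ofReal_lt_top)]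
  congr 1
  ext f
  rw [ENNReal.toReal_ofReal (hp.nonneg f), Complex.real_smul]

theorem IsPulse.integral_exp_spectralMeasure (hp : IsPulse p G β T) (t : ℝ) :
    ∫ f : ℝ, Complex.exp (2 * Real.pi * Complex.I * f * t) ∂spectralMeasure G =
      (matchedResponse p t : ℂ) := by
  rw [hp.integral_spectralMeasure, hp.fourier_inversion]

/-- The Fourier monomials span a dense subspace of the continuous functions, and integration against
a finite measure is continuous in the uniform norm. -/
theorem _root_.AddCircle.measure_ext_of_integral_fourier {P : ℝ} [Fact (0 < P)]
    {μ ν : Measure (AddCircle P)} [IsFiniteMeasure μ] [IsFiniteMeasure ν]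
    (h : ∀ n : ℤ, ∫ x, fourier n x ∂μ = ∫ x, fourier n x ∂ν) : μ = ν := by
  have hcont : ∀ (μ : Measure (AddCircle P)) [IsFiniteMeasure μ],
      Continuous fun f : C(AddCircle P, ℂ) => ∫ x, f x ∂μ := by
    intro μ _
    have h1 : Continuous fun f : C(AddCircle P, ℂ) => ∫ x, ContinuousMap.toLp 1 μ ℂ f x ∂μ :=
      continuous_integral.comp (ContinuousMap.toLp 1 μ ℂ).continuous
    convert h1 using 2 with f
    exact integral_congr_ae (ContinuousMap.coeFn_toLp μ f).symm
  have hint : ∀ (μ : Measure (AddCircle P)) [IsFiniteMeasure μ] (f : C(AddCircle P, ℂ)),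
      Integrable f μ := fun μ _ f => f.continuous.integrable_of_hasCompactSupport
        (HasCompactSupport.of_compactSpace f)
  have hall : ∀ f : C(AddCircle P, ℂ), ∫ x, f x ∂μ = ∫ x, f x ∂ν := by
    intro f
    have hcl : IsClosed {f : C(AddCircle P, ℂ) | ∫ x, f x ∂μ = ∫ x, f x ∂ν} :=
      isClosed_eq (hcont μ) (hcont ν)
    have hf : f ∈ (Submodule.span ℂ (Set.range (@fourier P))).topologicalClosure := by
      rw [span_fourier_closure_eq_top]; trivial
    rw [← SetLike.mem_coe, Submodule.topologicalClosure_coe] at hf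
    refine closure_minimal ?_ hcl hf
    intro g hg
    refine Submodule.span_induction (p := fun g _ => ∫ x, g x ∂μ = ∫ x, g x ∂ν)
      ?_ (by simp) ?_ ?_ hg
    · rintro _ ⟨n, rfl⟩
      exact h n
    · intro a b _ _ ha hb
      simp only [ContinuousMap.add_apply]
      rw [integral_add (hint _ _) (hint _ _), integral_add (hint _ _) (hint _ _), ha, hb]
    · intro c a _ ha
      simp only [ContinuousMap.smul_apply]
      rw [integral_smul, integral_smul, ha]
  refine ext_of_forall_integral_eq_of_IsFiniteMeasure fun f => ?_
  have := hall ⟨fun x => (f x : ℂ), by fun_prop⟩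
  simp only [ContinuousMap.coe_mk] at this
  rw [integral_complex_ofReal, integral_complex_ofReal] at this
  exact_mod_cast this

theorem _root_.AddCircle.integral_fourier {P : ℝ} [Fact (0 < P)] (n : ℤ) :
    ∫ x : AddCircle P, fourier n x ∂AddCircle.haarAddCircle = if n = 0 then 1 else 0 := by
  have h := congrFun (fourierCoeff_fourier (T := P) n) 0
  simp only [fourierCoeff, neg_zero, fourier_zero, one_smul] at h
  rw [h, Pi.single_apply]
  simp only [eq_comm]

/-- The samples `g(nT)` are the Fourier coefficients of the energy spectrum folded modulo `1 / T`;
those of an interference-free pulse are the coefficients of Haar measure. The measure form of the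
criterion avoids pointwise statements about the folded sum. -/
theorem IsPulse.map_spectralMeasure (hT : 0 < T) (hp : IsPulse p G β T) [Fact (0 < 1 / T)] :
    (spectralMeasure G).map ((↑) : ℝ → AddCircle (1 / T)) = AddCircle.haarAddCircle := by
  have := hp.isFiniteMeasure
  have hm : Measurable ((↑) : ℝ → AddCircle (1 / T)) := AddCircle.measurable_mk'
  have : IsFiniteMeasure ((spectralMeasure G).map ((↑) : ℝ → AddCircle (1 / T))) := by
    infer_instance
  refine AddCircle.measure_ext_of_integral_fourier fun n => ?_
  rw [AddCircle.integral_fourier, integral_map hm.aemeasurable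
    (fourier n).continuous.aestronglyMeasurable]
  have h1 := hp.integral_exp_spectralMeasure (n * T)
  rw [hp.no_isi] at h1
  have h2 : ((if n = 0 then (1 : ℝ) else 0 : ℝ) : ℂ) = if n = 0 then 1 else 0 := by
    split_ifs <;> simp
  rw [← h2, ← h1]
  congr 1
  ext f
  rw [fourier_coe_apply]
  congr 1
  push_cast
  field_simp

/-- Folding can only add mass, and the folded measure has density `T`. If `G f > T`, continuity
gives `G > a > T` on a ball of radius `ε`, whose mass is at least `2 ε a`, although its image on the
circle has mass at most `2 ε T`. -/
theorem IsPulse.le_period (hT : 0 < T) (hp : IsPulse p G β T) (f : ℝ) : G f ≤ T := by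
  rcases lt_or_ge |f| ((1 + β) / (2 * T)) with h | h
  swap
  · rw [hp.zero_off_band f h]; exact hT.le
  by_contra! hlt
  have hfact : Fact (0 < 1 / T) := ⟨by positivity⟩
  obtain ⟨a, ha1, ha2⟩ := exists_between hlt
  have hcont := hp.continuousOn_band.continuousAt ((isOpen_band _).mem_nhds h)
  obtain ⟨ε, hε, hball⟩ := Metric.eventually_nhds_iff.1 (hcont.eventually (lt_mem_nhds ha2))
  have h1 : spectralMeasure G (Metric.ball f ε) ≤ ENNReal.ofReal (2 * ε * T) := by
    calc spectralMeasure G (Metric.ball f ε)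
        ≤ spectralMeasure G (((↑) : ℝ → AddCircle (1 / T)) ⁻¹'
          Metric.closedBall (f : AddCircle (1 / T)) ε) := by
          refine measure_mono fun x hx => ?_
          rw [Set.mem_preimage, Metric.mem_closedBall, dist_eq_norm, ← AddCircle.coe_sub]
          refine (QuotientAddGroup.norm_mk_le_norm).trans ?_
          rw [← dist_eq_norm]
          exact (Metric.mem_ball.1 hx).le
      _ = AddCircle.haarAddCircle (Metric.closedBall (f : AddCircle (1 / T)) ε) := by
          rw [← hp.map_spectralMeasure hT, Measure.map_apply AddCircle.measurable_mk'
            Metric.isClosed_closedBall.measurableSet]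
      _ ≤ ENNReal.ofReal (2 * ε * T) := by
          have hv := AddCircle.volume_closedBall (T := 1 / T) (x := (f : AddCircle (1 / T))) ε
          rw [AddCircle.volume_eq_smul_haarAddCircle, Measure.smul_apply, smul_eq_mul] at hv
          have h2 : ENNReal.ofReal (1 / T) * AddCircle.haarAddCircle
              (Metric.closedBall (f : AddCircle (1 / T)) ε) ≤
              ENNReal.ofReal (1 / T) * ENNReal.ofReal (2 * ε * T) := by
            rw [hv, ← ENNReal.ofReal_mul (by positivity)]
            apply ENNReal.ofReal_le_ofReal
            refine (min_le_right _ _).trans (le_of_eq ?_)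
            field_simp
          exact (ENNReal.mul_le_mul_iff_right (by simpa using hT) ENNReal.ofReal_ne_top).1 h2
  have h2 : ENNReal.ofReal (a * (2 * ε)) ≤ spectralMeasure G (Metric.ball f ε) := by
    rw [spectralMeasure, withDensity_apply _ Metric.isOpen_ball.measurableSet]
    calc ENNReal.ofReal (a * (2 * ε)) = ∫⁻ _ in Metric.ball f ε, ENNReal.ofReal a := by
          rw [setLIntegral_const, Real.volume_ball, ENNReal.ofReal_mul (by linarith)]
      _ ≤ _ := setLIntegral_mono hp.measurable.ennreal_ofReal fun x hx =>
          ENNReal.ofReal_le_ofReal (hball hx).le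
  have h3 := (ENNReal.ofReal_le_ofReal_iff (by positivity)).1 (h2.trans h1)
  nlinarith

end Pulse

/-! ### Midpoint Riemann sums on `[-1/2, 1/2]`. -/

section RiemannSum

variable {E : Type*} [NormedAddCommGroup E] [NormedSpace ℝ E] [CompleteSpace E]

/-- The points `i / N`, `|i| ≤ M`, are the midpoints of `N = 2 M + 1` cells that tile the interval
exactly, so the sum is the integral of a step function and dominated convergence becomes available.
-/
theorem integral_round_div (F : ℝ → E) (M : ℕ) :
    ∫ x in (-(1 / 2 : ℝ))..(1 / 2), F (round (blockLength M * x) / blockLength M) =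
      (1 / blockLength M) • ∑ n : Fin (2 * M + 1), F (centred M n / blockLength M) := by
  have hN := blockLength_pos M
  rw [intervalIntegral.integral_comp_mul_left (fun y => F (round y / blockLength M)) hN.ne',
    one_div (blockLength M)]
  congr 1
  -- Open cells suffice for the integral, and they avoid the half-integer endpoints, where the
  -- rounding jumps.
  have hcell : ∀ k : ℕ, Set.EqOn (fun y : ℝ => F (round y / blockLength M))
      (fun _ => F (((k : ℤ) - (M : ℤ) : ℤ) / blockLength M))
      (Set.uIoo ((k : ℝ) - M - 1 / 2) (((k + 1 : ℕ) : ℝ) - M - 1 / 2)) := by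
    intro k y hy
    rw [Set.uIoo_of_le (by push_cast; linarith)] at hy
    have : round y = (k : ℤ) - M := by
      rw [round_eq, Int.floor_eq_iff]
      have h1 := hy.1
      have h2 := hy.2
      push_cast at h1 h2 ⊢
      constructor <;> linarith
    simp only [this]
  have hint : ∀ k < 2 * M + 1, IntervalIntegrable (fun y : ℝ => F (round y / blockLength M)) volume
      ((k : ℝ) - M - 1 / 2) (((k + 1 : ℕ) : ℝ) - M - 1 / 2) := by
    intro k _
    exact (intervalIntegrable_congr_uIoo (hcell k)).2 intervalIntegrable_const
  have hsum := intervalIntegral.sum_integral_adjacent_intervals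
    (a := fun k : ℕ => (k : ℝ) - M - 1 / 2) hint
  have h0 : blockLength M * -(1 / 2) = ((0 : ℕ) : ℝ) - M - 1 / 2 := by
    unfold blockLength; push_cast; ring
  have h1 : blockLength M * (1 / 2) = ((2 * M + 1 : ℕ) : ℝ) - M - 1 / 2 := by
    unfold blockLength; push_cast; ring
  rw [h0, h1, ← hsum, ← Fin.sum_univ_eq_sum_range
    (fun k : ℕ => ∫ y in ((k : ℝ) - M - 1 / 2)..(((k + 1 : ℕ) : ℝ) - M - 1 / 2),
      F (round y / blockLength M))]
  refine Finset.sum_congr rfl fun n _ => ?_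
  rw [intervalIntegral.integral_congr_uIoo (hcell n), intervalIntegral.integral_const]
  have : (((n : ℕ) + 1 : ℕ) : ℝ) - M - 1 / 2 - ((n : ℕ) - M - 1 / 2) = 1 := by push_cast; ring
  rw [this, one_smul]
  rfl

theorem abs_round_div_sub_le (M : ℕ) (x : ℝ) :
    |round (blockLength M * x) / blockLength M - x| ≤ 1 / 2 / blockLength M := by
  have hN := blockLength_pos M
  have h1 := abs_sub_round (blockLength M * x)
  have h2 : round (blockLength M * x) / blockLength M - x =
      -(blockLength M * x - round (blockLength M * x)) / blockLength M := by
    field_simp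
    ring
  rw [h2, abs_div, abs_neg, abs_of_pos hN]
  gcongr

theorem tendsto_blockLength : Tendsto blockLength atTop atTop := by
  unfold blockLength
  exact tendsto_atTop_add_const_right _ _
    (tendsto_natCast_atTop_atTop.const_mul_atTop two_pos)

theorem tendsto_round_div (x : ℝ) :
    Tendsto (fun M : ℕ => (round (blockLength M * x) / blockLength M : ℝ)) atTop (𝓝 x) := by
  rw [tendsto_iff_dist_tendsto_zero]
  refine squeeze_zero (fun _ => dist_nonneg) (fun M => abs_round_div_sub_le M x) ?_
  exact tendsto_const_nhds.div_atTop tendsto_blockLength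

/-- Riemann sums of a bounded, almost everywhere continuous function converge. -/
theorem tendsto_riemannSum {F : ℝ → E} (hF : StronglyMeasurable F) {C : ℝ}
    (hC : ∀ x, ‖F x‖ ≤ C) (hcont : ∀ᵐ x : ℝ, ContinuousAt F x) :
    Tendsto (fun M : ℕ =>
        (1 / blockLength M) • ∑ n : Fin (2 * M + 1), F (centred M n / blockLength M))
      atTop (𝓝 (∫ x in (-(1 / 2 : ℝ))..(1 / 2), F x)) := by
  simp only [← integral_round_div]
  refine intervalIntegral.tendsto_integral_filter_of_dominated_convergence (fun _ => C)
    (.of_forall fun M => ?_) (.of_forall fun M => .of_forall fun x _ => hC _)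
    intervalIntegrable_const ?_
  · refine (hF.comp_measurable ?_).aestronglyMeasurable
    have : Measurable fun x : ℝ => ((round (blockLength M * x) : ℤ) : ℝ) := by
      simp only [round_eq]
      exact measurable_from_top.comp (Int.measurable_floor.comp (by fun_prop))
    exact this.div_const _
  · filter_upwards [hcont] with x hx _
    exact hx.tendsto.comp (tendsto_round_div x)

end RiemannSum

/-! ### The folded spectrum: support, bound, continuity and Fourier coefficients. -/

section FoldedSpectrum

variable {p G : ℝ → ℝ} {β T δ : ℝ}

theorem IsPulse.scaled_eq_zero (hT : 0 < T) (hδ : 0 < δ) (hp : IsPulse p G β T) {u : ℝ}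
    (hu : δ * (1 + β) / 2 ≤ |u|) : G (u / (δ * T)) = 0 := by
  apply hp.zero_off_band
  rw [abs_div, abs_of_pos (mul_pos hδ hT), le_div_iff₀ (mul_pos hδ hT)]
  refine le_trans (le_of_eq ?_) hu
  field_simp

theorem IsPulse.scaled_pos (hT : 0 < T) (hδ : 0 < δ) (hp : IsPulse p G β T) {u : ℝ}
    (hu : |u| < δ * (1 + β) / 2) : 0 < G (u / (δ * T)) := by
  apply hp.pos_in_band
  rw [abs_div, abs_of_pos (mul_pos hδ hT), div_lt_iff₀ (mul_pos hδ hT)]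
  refine lt_of_lt_of_eq hu ?_
  field_simp

/-- The three summands of the folded spectrum that can be nonzero on `(-1, 1)`. -/
def foldedCore (G : ℝ → ℝ) (δ T f : ℝ) : ℝ :=
  1 / (δ * T) * (G ((f + 1) / (δ * T)) + G (f / (δ * T)) + G ((f - 1) / (δ * T)))

theorem half_width_le_one (hβ1 : β ≤ 1) (hδ : 0 < δ) (hδ1 : δ ≤ 1) : δ * (1 + β) / 2 ≤ 1 := by
  nlinarith

/-- The scaled spectrum vanishes for `|u| ≥ δ (1 + β) / 2`, a number at most `1`, so shifts by two
or more do not reach `(-1, 1)`. Measurability, bound and continuity are then proved for a finite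
sum. -/
theorem IsPulse.foldedSpectrum_eq_core (hβ1 : β ≤ 1) (hT : 0 < T) (hδ : 0 < δ) (hδ1 : δ ≤ 1)
    (hp : IsPulse p G β T) {f : ℝ} (hf : |f| < 1) :
    foldedSpectrum G δ T f = foldedCore G δ T f := by
  unfold foldedSpectrum foldedCore
  congr 1
  rw [tsum_eq_sum (s := {-1, 0, 1})]
  · rw [Finset.sum_insert (by decide), Finset.sum_insert (by decide), Finset.sum_singleton]
    push_cast
    ring_nf
  · intro m hm
    refine hp.scaled_eq_zero hT hδ ((half_width_le_one hβ1 hδ hδ1).trans ?_)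
    simp only [Finset.mem_insert, Finset.mem_singleton, not_or] at hm
    obtain ⟨h1, h2⟩ := abs_lt.1 hf
    have : m ≤ -2 ∨ 2 ≤ m := by omega
    rcases this with h | h
    · have : (m : ℝ) ≤ -2 := by exact_mod_cast h
      exact le_abs.2 (.inl (by linarith))
    · have : (2 : ℝ) ≤ m := by exact_mod_cast h
      exact le_abs.2 (.inr (by linarith))

theorem IsPulse.measurable_foldedCore (hp : IsPulse p G β T) (δ : ℝ) :
    Measurable (foldedCore G δ T) := by
  have := hp.measurable
  unfold foldedCore
  fun_prop

theorem IsPulse.foldedCore_nonneg (hT : 0 < T) (hδ : 0 < δ) (hp : IsPulse p G β T) (f : ℝ) :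
    0 ≤ foldedCore G δ T f := by
  have h1 := hp.nonneg ((f + 1) / (δ * T))
  have h2 := hp.nonneg (f / (δ * T))
  have h3 := hp.nonneg ((f - 1) / (δ * T))
  unfold foldedCore
  positivity

theorem IsPulse.norm_foldedCore_le (hT : 0 < T) (hδ : 0 < δ) (hp : IsPulse p G β T) (f : ℝ) :
    ‖foldedCore G δ T f‖ ≤ 3 / δ := by
  rw [Real.norm_of_nonneg (hp.foldedCore_nonneg hT hδ f)]
  have h1 := hp.le_period hT ((f + 1) / (δ * T))
  have h2 := hp.le_period hT (f / (δ * T))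
  have h3 := hp.le_period hT ((f - 1) / (δ * T))
  calc foldedCore G δ T f ≤ 1 / (δ * T) * (T + T + T) := by unfold foldedCore; gcongr
    _ = 3 / δ := by field_simp; norm_num

theorem IsPulse.continuousAt (hp : IsPulse p G β T) {f : ℝ} (hf : |f| ≠ (1 + β) / (2 * T)) :
    ContinuousAt G f := by
  rcases lt_or_gt_of_ne hf with h | h
  · exact hp.continuousOn_band.continuousAt ((isOpen_band _).mem_nhds h)
  · have : G =ᶠ[𝓝 f] fun _ => 0 := by
      filter_upwards [(isOpen_lt continuous_const continuous_abs).mem_nhds h] with x hx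
      exact hp.zero_off_band x (le_of_lt hx)
    exact continuousAt_const.congr this.symm

/-- `G` may jump at the band edges, as for the sinc pulse; the three shifts produce only finitely
many such points. -/
theorem IsPulse.ae_continuousAt_foldedCore (hT : 0 < T) (hδ : 0 < δ) (hp : IsPulse p G β T) :
    ∀ᵐ f : ℝ, ContinuousAt (foldedCore G δ T) f := by
  have hd : δ * T ≠ 0 := (mul_pos hδ hT).ne'
  have hbad : ∀ s : ℝ, ∀ᵐ f : ℝ, |(f + s) / (δ * T)| ≠ (1 + β) / (2 * T) := by
    intro s
    have hfin : {f : ℝ | |(f + s) / (δ * T)| = (1 + β) / (2 * T)}.Finite := by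
      refine (Set.toFinite {(1 + β) / (2 * T) * (δ * T) - s,
        -((1 + β) / (2 * T)) * (δ * T) - s}).subset fun f hf => ?_
      rcases eq_or_eq_neg_of_abs_eq hf with h | h
      · left; rw [← h]; field_simp; ring
      · right; rw [Set.mem_singleton_iff, ← h]; field_simp; ring
    have := hfin.countable.ae_notMem volume
    filter_upwards [this] with f hf using hf
  filter_upwards [hbad 1, hbad 0, hbad (-1)] with f h1 h2 h3
  rw [add_zero] at h2
  rw [← sub_eq_add_neg] at h3
  unfold foldedCore
  refine continuousAt_const.mul (((?_ : ContinuousAt _ f).add ?_).add ?_)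
  · exact ContinuousAt.comp (f := fun f : ℝ => (f + 1) / (δ * T)) (hp.continuousAt h1)
      (by fun_prop)
  · exact ContinuousAt.comp (f := fun f : ℝ => f / (δ * T)) (hp.continuousAt h2)
      (by fun_prop)
  · exact ContinuousAt.comp (f := fun f : ℝ => (f - 1) / (δ * T)) (hp.continuousAt h3)
      (by fun_prop)

theorem neg_half_lt_half : -(1 / 2 : ℝ) < 1 / 2 := by norm_num

theorem fourierCoeffOn_unit (F : ℝ → ℂ) (k : ℤ) : fourierCoeffOn neg_half_lt_half F k =
    ∫ f in (-(1 / 2 : ℝ))..(1 / 2), Complex.exp (-(2 * Real.pi * Complex.I * k * f)) * F f := by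
  rw [fourierCoeffOn_eq_integral]
  have h1 : (1 / 2 - -(1 / 2) : ℝ) = 1 := by norm_num
  simp only [fourier_coe_apply, h1, div_one, one_smul, smul_eq_mul, Complex.ofReal_one]
  congr 1
  ext f
  congr 2
  push_cast
  ring

/-- The entries of the Toeplitz matrix are the Fourier coefficients of the folded spectrum. -/
theorem IsPulse.fourierCoeffOn_foldedCore (hβ1 : β ≤ 1) (hT : 0 < T) (hδ : 0 < δ) (hδ1 : δ ≤ 1)
    (hp : IsPulse p G β T) (k : ℤ) :
    fourierCoeffOn neg_half_lt_half (fun f => (foldedCore G δ T f : ℂ)) k =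
      (matchedResponse p (k * (δ * T)) : ℂ) := by
  have hd : 0 < δ * T := mul_pos hδ hT
  rw [fourierCoeffOn_unit]
  set e : ℝ → ℂ := fun f => Complex.exp (-(2 * Real.pi * Complex.I * k * f)) with he
  have hper : ∀ f : ℝ, e (f + 1) = e f := by
    intro f
    simp only [he]
    rw [Complex.exp_eq_exp_iff_exists_int]
    exact ⟨-k, by push_cast; ring⟩
  set H : ℝ → ℂ := fun u => e u * (G (u / (δ * T)) : ℂ) with hH
  have hHint : Integrable H := by
    refine ((hp.integrable_spectrum.comp_div hd.ne').ofReal (𝕜 := ℂ)).bdd_mul (c := 1) ?_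
      (.of_forall fun f => ?_)
    · exact Continuous.aestronglyMeasurable (by fun_prop)
    · simp [he, Complex.norm_exp]
  have hII : ∀ a b : ℝ, IntervalIntegrable H volume a b := fun a b => hHint.intervalIntegrable
  have hII' : ∀ c a b : ℝ, IntervalIntegrable (fun u => H (u + c)) volume a b := fun c a b =>
    (hHint.comp_add_right c).intervalIntegrable
  have hline : (matchedResponse p (k * (δ * T)) : ℂ) = 1 / ((δ * T : ℝ) : ℂ) * ∫ u, H u := by
    -- Evenness of `g` gives the exponential the sign that it has in a Fourier coefficient.
    rw [← matchedResponse_neg, hp.fourier_inversion]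
    have := Measure.integral_comp_div (fun f : ℝ => (G f : ℂ) *
      Complex.exp (2 * Real.pi * Complex.I * f * ((-(k * (δ * T)) : ℝ) : ℂ))) (δ * T)
    have h2 : ∀ u : ℝ, (G (u / (δ * T)) : ℂ) * Complex.exp (2 * Real.pi * Complex.I *
        ((u / (δ * T) : ℝ) : ℂ) * ((-(k * (δ * T)) : ℝ) : ℂ)) = H u := by
      intro u
      simp only [hH, he]
      rw [mul_comm]
      congr 2
      have : (δ : ℂ) * T ≠ 0 := by exact_mod_cast hd.ne'
      push_cast
      field_simp
    simp only [h2] at this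
    rw [this, abs_of_pos hd, Complex.real_smul, one_div, inv_mul_cancel_left₀]
    exact_mod_cast hd.ne'
  have hsupp : ∫ u, H u = ∫ u in (-(3 / 2 : ℝ))..(3 / 2), H u := by
    rw [intervalIntegral.integral_eq_integral_of_support_subset]
    intro u hu
    by_contra hcon
    apply hu
    have : 1 ≤ |u| := by
      by_contra! hlt
      obtain ⟨h1, h2⟩ := abs_lt.1 hlt
      exact hcon ⟨by linarith, by linarith⟩
    simp only [hH]
    rw [hp.scaled_eq_zero hT hδ ((half_width_le_one hβ1 hδ hδ1).trans this)]
    simp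
  -- Three unit periods cover the support. Translating the outer two onto the middle one yields the
  -- three summands of `foldedCore`, since `e` has period `1`.
  have hsplit : ∫ u in (-(3 / 2 : ℝ))..(3 / 2), H u =
      ∫ f in (-(1 / 2 : ℝ))..(1 / 2), (H (f + -1) + H f + H (f + 1)) := by
    rw [intervalIntegral.integral_add ((hII' _ _ _).add (hII _ _)) (hII' _ _ _),
      intervalIntegral.integral_add (hII' _ _ _) (hII _ _),
      intervalIntegral.integral_comp_add_right, intervalIntegral.integral_comp_add_right,
      ← intervalIntegral.integral_add_adjacent_intervals (hII (-(3 / 2)) (-(1 / 2)))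
        (hII (-(1 / 2)) (3 / 2)),
      ← intervalIntegral.integral_add_adjacent_intervals (hII (-(1 / 2)) (1 / 2))
        (hII (1 / 2) (3 / 2))]
    norm_num
    ring
  rw [hline, hsupp, hsplit, ← intervalIntegral.integral_const_mul]
  congr 1
  ext f
  have hm : e (f + -1) = e f := by rw [← hper (f + -1)]; ring_nf
  simp only [hH, foldedCore, hper, hm]
  push_cast
  rw [← sub_eq_add_neg]
  ring

end FoldedSpectrum

/-! ### The unitary DFT, circulant matrices and the reduced channel factor. -/

section Dft

open Matrix

theorem blockLength_cast (M : ℕ) : ((2 * M + 1 : ℕ) : ℝ) = blockLength M := by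
  unfold blockLength; push_cast; ring

theorem blockLength_ne_zero (M : ℕ) : (blockLength M : ℂ) ≠ 0 := by
  exact_mod_cast (blockLength_pos M).ne'

theorem sqrt_blockLength_inv_mul_self (M : ℕ) :
    ((1 / Real.sqrt (blockLength M) : ℝ) : ℂ) * ((1 / Real.sqrt (blockLength M) : ℝ) : ℂ) =
      1 / (blockLength M : ℂ) := by
  rw [← Complex.ofReal_mul, div_mul_div_comm, one_mul, Real.mul_self_sqrt (blockLength_pos M).le]
  push_cast
  rfl

theorem star_dft_mul_dft (M : ℕ) (k n m : Fin (2 * M + 1)) :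
    star (dft M k n) * dft M k m = 1 / (blockLength M : ℂ) *
      Complex.exp (2 * Real.pi * Complex.I * ((centred M n - centred M m : ℤ) : ℂ) /
        blockLength M) ^ (k : ℕ) := by
  simp only [dft, of_apply, star_mul', RCLike.star_def, Complex.conj_ofReal]
  rw [mul_mul_mul_comm, sqrt_blockLength_inv_mul_self, ← Complex.exp_conj, ← Complex.exp_add,
    ← Complex.exp_nat_mul]
  congr 2
  simp only [map_neg, map_mul, map_div₀, Complex.conj_I, Complex.conj_ofReal, map_ofNat,
    Complex.conj_natCast, map_intCast]
  push_cast
  ring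

theorem conjTranspose_dft_mul_dft (M : ℕ) : (dft M)ᴴ * dft M = 1 := by
  ext n m
  rw [mul_apply]
  simp only [conjTranspose_apply, star_dft_mul_dft, ← Finset.mul_sum]
  set z := Complex.exp (2 * Real.pi * Complex.I * ((centred M n - centred M m : ℤ) : ℂ) /
        blockLength M) with hz
  rw [Fin.sum_univ_eq_sum_range (fun k => z ^ k)]
  have hN := blockLength_ne_zero M
  rcases eq_or_ne n m with rfl | hne
  · have : z = 1 := by simp [hz]
    rw [this]
    simp only [one_pow, Finset.sum_const, Finset.card_range, nsmul_eq_mul, mul_one, one_apply_eq]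
    have h2 : ((2 * M + 1 : ℕ) : ℂ) = (blockLength M : ℂ) := by
      rw [← blockLength_cast]; push_cast; rfl
    rw [h2, one_div_mul_cancel hN]
  · rw [one_apply_ne hne]
    have h1 : z ^ (2 * M + 1) = 1 := by
      rw [hz, ← Complex.exp_nat_mul, Complex.exp_eq_one_iff]
      refine ⟨centred M n - centred M m, ?_⟩
      have h2 : ((2 * M + 1 : ℕ) : ℂ) = (blockLength M : ℂ) := by
        rw [← blockLength_cast]; push_cast; rfl
      rw [h2]
      field_simp
    have h2 : z ≠ 1 := by
      intro h
      rw [hz, Complex.exp_eq_one_iff] at h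
      obtain ⟨j, hj⟩ := h
      have h3 : ((centred M n - centred M m : ℤ) : ℂ) = j * blockLength M := by
        field_simp at hj
        linear_combination hj
      have h4 : centred M n - centred M m = j * (2 * M + 1 : ℤ) := by
        unfold blockLength at h3
        exact_mod_cast h3
      simp only [centred] at h4
      have h5 : ((n : ℕ) : ℤ) - (m : ℕ) = j * (2 * M + 1 : ℤ) := by linarith
      have hn := n.2
      have hm := m.2
      have hj0 : j = 0 := by
        by_contra hj0
        rcases lt_or_gt_of_ne hj0 with hlt | hgt
        · have : j * (2 * M + 1 : ℤ) ≤ -1 * (2 * M + 1 : ℤ) :=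
            mul_le_mul_of_nonneg_right (by omega) (by positivity)
          omega
        · have : 1 * (2 * M + 1 : ℤ) ≤ j * (2 * M + 1 : ℤ) :=
            mul_le_mul_of_nonneg_right (by omega) (by positivity)
          omega
      rw [hj0] at h5
      apply hne
      ext
      omega
    have h3 := mul_geom_sum z (2 * M + 1)
    rw [h1, sub_self] at h3
    rw [(mul_eq_zero.1 h3).resolve_left (sub_ne_zero.2 h2), mul_zero]

theorem dft_mul_conjTranspose_dft (M : ℕ) : dft M * (dft M)ᴴ = 1 :=
  mul_eq_one_comm.1 (conjTranspose_dft_mul_dft M)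

/-- The `k`-th diagonal of the circulant matrix that belongs to the samples `d(i)`. -/
def circCoeff (M : ℕ) (d : ℤ → ℝ) (k : ℤ) : ℂ :=
  (1 / blockLength M) • ∑ i : Fin (2 * M + 1),
    Complex.exp (-(2 * Real.pi * Complex.I * k * ((centred M i / blockLength M : ℝ) : ℂ))) *
      (d (centred M i) : ℂ)

/-- An entry depends only on `n - m`; if `d` samples a function, the entry is a Riemann sum of one
of its Fourier coefficients. -/
theorem dftDiag_apply (M : ℕ) (d : ℤ → ℝ) (n m : Fin (2 * M + 1)) :
    dftDiag M d n m = circCoeff M d ((n : ℕ) - (m : ℕ)) := by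
  unfold dftDiag circCoeff
  rw [mul_apply, Finset.smul_sum]
  refine Finset.sum_congr rfl fun i _ => ?_
  rw [mul_diagonal, conjTranspose_apply, mul_right_comm]
  have : dft M n i * star (dft M m i) = 1 / (blockLength M : ℂ) *
      Complex.exp (-(2 * Real.pi * Complex.I * (((n : ℕ) - (m : ℕ) : ℤ) : ℂ) *
        ((centred M i / blockLength M : ℝ) : ℂ))) := by
    simp only [dft, of_apply, star_mul', RCLike.star_def, Complex.conj_ofReal]
    rw [mul_mul_mul_comm, sqrt_blockLength_inv_mul_self, ← Complex.exp_conj, ← Complex.exp_add]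
    congr 2
    simp only [map_neg, map_mul, map_div₀, Complex.conj_I, Complex.conj_ofReal, map_ofNat,
      Complex.conj_natCast, map_intCast]
    push_cast
    ring
  rw [this, Complex.real_smul]
  push_cast
  ring

theorem sum_norm_sq_eq_trace {n : Type*} [Fintype n] (A : Matrix n n ℂ) :
    ((∑ i, ∑ j, ‖A i j‖ ^ 2 : ℝ) : ℂ) = (A * Aᴴ).trace := by
  rw [trace]
  push_cast
  refine Finset.sum_congr rfl fun i _ => ?_
  rw [diag_apply, mul_apply]
  refine Finset.sum_congr rfl fun j _ => ?_
  rw [conjTranspose_apply, RCLike.star_def, Complex.mul_conj']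

theorem dftDiag_isHermitian (M : ℕ) (d : ℤ → ℝ) : (dftDiag M d)ᴴ = dftDiag M d := by
  unfold dftDiag
  rw [conjTranspose_mul, conjTranspose_mul, conjTranspose_conjTranspose, diagonal_conjTranspose,
    Matrix.mul_assoc]
  congr 3
  ext i
  simp

theorem dftDiag_mul (M : ℕ) (d e : ℤ → ℝ) :
    dftDiag M d * dftDiag M e = dftDiag M fun i => d i * e i := by
  unfold dftDiag
  calc _ = dft M * diagonal (fun n => (d (centred M n) : ℂ)) * ((dft M)ᴴ * dft M) *
        diagonal (fun n => (e (centred M n) : ℂ)) * (dft M)ᴴ := by simp only [Matrix.mul_assoc]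
    _ = _ := by
      rw [conjTranspose_dft_mul_dft, Matrix.mul_one, Matrix.mul_assoc (dft M), diagonal_mul_diagonal]
      simp only [Complex.ofReal_mul]

theorem trace_dftDiag (M : ℕ) (d : ℤ → ℝ) :
    (dftDiag M d).trace = ((∑ n, d (centred M n) : ℝ) : ℂ) := by
  unfold dftDiag
  rw [trace_mul_comm, ← Matrix.mul_assoc, conjTranspose_dft_mul_dft, Matrix.one_mul,
    trace_diagonal]
  push_cast
  rfl

theorem sum_norm_sq_dftDiag (M : ℕ) (d : ℤ → ℝ) :
    ∑ n, ∑ m, ‖dftDiag M d n m‖ ^ 2 = ∑ n, d (centred M n) ^ 2 := by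
  have h := sum_norm_sq_eq_trace (dftDiag M d)
  rw [dftDiag_isHermitian, dftDiag_mul, trace_dftDiag] at h
  simp only [← sq] at h
  exact_mod_cast h

theorem dftDiag_posSemidef {M : ℕ} {d : ℤ → ℝ} (hd : ∀ i, 0 ≤ d i) :
    (dftDiag M d).PosSemidef := by
  unfold dftDiag
  refine PosSemidef.mul_mul_conjTranspose_same (.diagonal fun i => ?_) _
  simpa using hd _

theorem dftDiag_posDef {M : ℕ} {d : ℤ → ℝ} (hd : ∀ n, 0 < d (centred M n)) :
    (dftDiag M d).PosDef := by
  unfold dftDiag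
  refine PosDef.mul_mul_conjTranspose_same (.diagonal fun i => ?_) ?_
  · simpa using hd i
  · exact vecMul_injective_of_isUnit (IsUnit.of_mul_eq_one _ (dft_mul_conjTranspose_dft M))

/-- The rows of `Λ^{1/2} D†` that do not vanish. -/
def dftFactor (M : ℕ) (d : ℤ → ℝ) :
    Matrix {n : Fin (2 * M + 1) // d (centred M n) ≠ 0} (Fin (2 * M + 1)) ℂ :=
  of fun k m => (Real.sqrt (d (centred M k)) : ℂ) * star (dft M m k)

theorem conjTranspose_dftFactor_mul {M : ℕ} {d : ℤ → ℝ} (hd : ∀ i, 0 ≤ d i) :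
    (dftFactor M d)ᴴ * dftFactor M d = dftDiag M d := by
  classical
  ext n m
  unfold dftDiag
  rw [mul_apply, mul_apply]
  simp only [mul_diagonal, conjTranspose_apply, dftFactor, of_apply]
  rw [← Finset.sum_filter_add_sum_filter_not Finset.univ (fun k => d (centred M k) ≠ 0)
    (fun k => dft M n k * (d (centred M k) : ℂ) * star (dft M m k))]
  have h0 : ∑ k with ¬d (centred M k) ≠ 0,
      dft M n k * (d (centred M k) : ℂ) * star (dft M m k) = 0 := by
    refine Finset.sum_eq_zero fun k hk => ?_
    have : d (centred M k) = 0 := by simpa using hk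
    simp [this]
  rw [h0, add_zero, ← Finset.sum_subtype_eq_sum_filter, Finset.subtype_univ]
  refine Finset.sum_congr rfl fun k _ => ?_
  have h1 : (Real.sqrt (d (centred M k)) : ℂ) * Real.sqrt (d (centred M k)) =
      d (centred M k) := by
    rw [← Complex.ofReal_mul, Real.mul_self_sqrt (hd _)]
  simp only [star_mul', RCLike.star_def, Complex.conj_ofReal, Complex.conj_conj]
  linear_combination dft M n k * (starRingEnd ℂ) (dft M m k) * h1

/-- In the DFT basis the factor is `Λ^{1/2}` without its zero rows, so the product is diagonal with
entries `d s`. Values of `s` where `d` vanishes do not enter. -/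
theorem dftFactor_mul_dftDiag_mul {M : ℕ} {d s : ℤ → ℝ} (hd : ∀ i, 0 ≤ d i) {e : ℝ}
    (hds : ∀ n, d (centred M n) ≠ 0 → d (centred M n) * s (centred M n) = e) :
    dftFactor M d * dftDiag M s * (dftFactor M d)ᴴ = (e : ℂ) • 1 := by
  have h1 : ∀ (k : {n : Fin (2 * M + 1) // d (centred M n) ≠ 0}) (j : Fin (2 * M + 1)),
      (dftFactor M d * dft M) k j =
        if (k : Fin (2 * M + 1)) = j then (Real.sqrt (d (centred M k)) : ℂ) else 0 := by
    intro k j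
    have h := congrFun (congrFun (conjTranspose_dft_mul_dft M) k) j
    rw [mul_apply] at h ⊢
    simp only [dftFactor, of_apply, mul_assoc, ← Finset.mul_sum]
    simp only [conjTranspose_apply] at h
    rw [h, one_apply, mul_ite, mul_one, mul_zero]
  have h2 : dftFactor M d * dftDiag M s * (dftFactor M d)ᴴ =
      (dftFactor M d * dft M) * diagonal (fun n => (s (centred M n) : ℂ)) *
        (dftFactor M d * dft M)ᴴ := by
    rw [conjTranspose_mul]
    simp only [dftDiag, Matrix.mul_assoc]
  rw [h2]
  ext k l
  rw [mul_apply]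
  simp only [mul_diagonal, conjTranspose_apply, h1]
  rw [Finset.sum_eq_single (k : Fin (2 * M + 1))]
  · rcases eq_or_ne k l with rfl | hkl
    · rw [if_pos rfl, RCLike.star_def, Complex.conj_ofReal, Matrix.smul_apply, one_apply_eq, smul_eq_mul,
        mul_one, ← hds k k.2, ← Complex.ofReal_mul, ← Complex.ofReal_mul, mul_right_comm,
        Real.mul_self_sqrt (hd _)]
    · rw [if_pos rfl, if_neg fun h => hkl (Subtype.ext h.symm), star_zero, mul_zero, Matrix.smul_apply,
        one_apply_ne hkl, smul_zero]
  · intro j _ hj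
    rw [if_neg (Ne.symm hj), zero_mul, zero_mul]
  · simp

end Dft

/-! ### Asymptotic equivalence of the Toeplitz and circulant forms. -/

section Asymptotic

variable {M : ℕ}

theorem sum_sub_le_tsum {f : ℤ → ℝ} (hf : ∀ k, 0 ≤ f k) (hs : Summable f) :
    ∑ n : Fin (2 * M + 1), ∑ m : Fin (2 * M + 1), f ((n : ℕ) - (m : ℕ)) ≤
      blockLength M * ∑' k, f k := by
  have h : ∀ n : Fin (2 * M + 1), ∑ m : Fin (2 * M + 1), f ((n : ℕ) - (m : ℕ)) ≤ ∑' k, f k := by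
    intro n
    have hinj : Function.Injective fun m : Fin (2 * M + 1) => (((n : ℕ) : ℤ) - (m : ℕ)) := by
      intro a b hab
      simp only at hab
      ext
      omega
    have h := hs.sum_le_tsum (Finset.univ.map ⟨_, hinj⟩) fun k _ => hf k
    rwa [Finset.sum_map] at h
  refine (Finset.sum_le_sum fun n _ => h n).trans (le_of_eq ?_)
  rw [Finset.sum_const, Finset.card_univ, Fintype.card_fin, nsmul_eq_mul, blockLength_cast]

theorem le_card_sub_eq (M : ℕ) (k : ℤ) : 2 * M + 1 - k.natAbs ≤
    (Finset.univ.filter fun q : Fin (2 * M + 1) × Fin (2 * M + 1) =>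
      ((q.1 : ℕ) : ℤ) - (q.2 : ℕ) = k).card := by
  rw [← Finset.card_range (2 * M + 1 - k.natAbs)]
  have hmod : ∀ j ∈ Finset.range (2 * M + 1 - k.natAbs),
      (j + k.toNat) % (2 * M + 1) = j + k.toNat ∧
        (j + (-k).toNat) % (2 * M + 1) = j + (-k).toNat := by
    intro j hj
    rw [Finset.mem_range] at hj
    constructor <;> exact Nat.mod_eq_of_lt (by omega)
  -- The pair `(j + k⁺, j + k⁻)` has difference `k`, and `j < N - |k|` keeps both entries below `N`,
  -- so `Fin.ofNat` does not wrap around.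
  refine Finset.card_le_card_of_injOn (fun j =>
    (Fin.ofNat (2 * M + 1) (j + k.toNat), Fin.ofNat (2 * M + 1) (j + (-k).toNat))) ?_ ?_
  · intro j hj
    obtain ⟨h1, h2⟩ := hmod j hj
    simp only [Finset.coe_filter, Finset.mem_univ, true_and, Set.mem_ofPred_eq, Fin.val_ofNat, h1,
      h2]
    push_cast
    omega
  · intro i hi j hj hij
    have h3 := congrArg (fun q : Fin (2 * M + 1) × Fin (2 * M + 1) => (q.1 : ℕ)) hij
    simp only [Fin.val_ofNat, (hmod i hi).1, (hmod j hj).1] at h3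
    omega

/-- Diagonal `k` has at least `N - |k|` entries. For `|k| > N` the weight is negative, so `s` needs
no restriction. -/
theorem sum_mul_le_sum_sub {f : ℤ → ℝ} (hf : ∀ k, 0 ≤ f k) (s : Finset ℤ) :
    ∑ k ∈ s, (blockLength M - |(k : ℝ)|) * f k ≤
      ∑ n : Fin (2 * M + 1), ∑ m : Fin (2 * M + 1), f ((n : ℕ) - (m : ℕ)) := by
  classical
  rw [← Fintype.sum_prod_type'
    (f := fun (n m : Fin (2 * M + 1)) => f (((n : ℕ) : ℤ) - (m : ℕ)))]
  have h1 : ∀ k : ℤ, (blockLength M - |(k : ℝ)|) * f k ≤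
      ∑ q : Fin (2 * M + 1) × Fin (2 * M + 1) with ((q.1 : ℕ) : ℤ) - (q.2 : ℕ) = k,
        f (((q.1 : ℕ) : ℤ) - (q.2 : ℕ)) := by
    intro k
    have h2 : ∑ q : Fin (2 * M + 1) × Fin (2 * M + 1) with ((q.1 : ℕ) : ℤ) - (q.2 : ℕ) = k,
        f (((q.1 : ℕ) : ℤ) - (q.2 : ℕ)) = ∑ q : Fin (2 * M + 1) × Fin (2 * M + 1) with
          ((q.1 : ℕ) : ℤ) - (q.2 : ℕ) = k, f k := by
      refine Finset.sum_congr rfl fun q hq => ?_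
      rw [(Finset.mem_filter.1 hq).2]
    rw [h2, Finset.sum_const, nsmul_eq_mul]
    refine mul_le_mul_of_nonneg_right ?_ (hf k)
    have h3 := le_card_sub_eq M k
    rw [tsub_le_iff_right] at h3
    have h4 : ((2 * M + 1 : ℕ) : ℝ) ≤ ((Finset.univ.filter fun q :
        Fin (2 * M + 1) × Fin (2 * M + 1) => ((q.1 : ℕ) : ℤ) - (q.2 : ℕ) = k).card : ℝ) +
          (k.natAbs : ℝ) := by exact_mod_cast h3
    rw [blockLength_cast, Nat.cast_natAbs, Int.cast_abs] at h4
    linarith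
  refine (Finset.sum_le_sum fun k _ => h1 k).trans ?_
  rw [Finset.sum_fiberwise_eq_sum_filter]
  exact Finset.sum_le_sum_of_subset_of_nonneg (Finset.filter_subset _ _) fun q _ _ => hf _

/-- Matrices that are constant along diagonals and converge diagonal by diagonal and in normalised
Frobenius norm to a square summable sequence are asymptotically equivalent to its Toeplitz
matrices. -/
theorem tendsto_toeplitz_sub {a : ℤ → ℂ} {c : ℕ → ℤ → ℂ} {I : ℝ}
    (ha : HasSum (fun k => ‖a k‖ ^ 2) I)
    (hc : ∀ k, Tendsto (fun M => c M k) atTop (𝓝 (a k)))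
    (hn : Tendsto (fun M : ℕ => (∑ n : Fin (2 * M + 1), ∑ m : Fin (2 * M + 1),
      ‖c M ((n : ℕ) - (m : ℕ))‖ ^ 2) / blockLength M) atTop (𝓝 I)) :
    Tendsto (fun M : ℕ => (∑ n : Fin (2 * M + 1), ∑ m : Fin (2 * M + 1),
      ‖a ((n : ℕ) - (m : ℕ)) - c M ((n : ℕ) - (m : ℕ))‖ ^ 2) / blockLength M) atTop (𝓝 0) := by
  -- Parallelogram law: the norm of `a - c` is controlled from above by bounding that of `a + c`
  -- from below, for which finitely many diagonals suffice.
  have hbound : ∀ (s : Finset ℤ) (M : ℕ), (∑ n : Fin (2 * M + 1), ∑ m : Fin (2 * M + 1),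
      ‖a ((n : ℕ) - (m : ℕ)) - c M ((n : ℕ) - (m : ℕ))‖ ^ 2) / blockLength M ≤
      2 * I + 2 * ((∑ n : Fin (2 * M + 1), ∑ m : Fin (2 * M + 1),
        ‖c M ((n : ℕ) - (m : ℕ))‖ ^ 2) / blockLength M) -
      ∑ k ∈ s, (1 - |(k : ℝ)| / blockLength M) * ‖a k + c M k‖ ^ 2 := by
    intro s M
    have hN := blockLength_pos M
    have h1 := sum_sub_le_tsum (M := M) (fun k => sq_nonneg ‖a k‖) ha.summable
    have h2 := sum_mul_le_sum_sub (M := M) (fun k => sq_nonneg ‖a k + c M k‖) s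
    rw [ha.tsum_eq] at h1
    have h3 : ∑ n : Fin (2 * M + 1), ∑ m : Fin (2 * M + 1),
        ‖a ((n : ℕ) - (m : ℕ)) + c M ((n : ℕ) - (m : ℕ))‖ ^ 2 +
        ∑ n : Fin (2 * M + 1), ∑ m : Fin (2 * M + 1),
          ‖a ((n : ℕ) - (m : ℕ)) - c M ((n : ℕ) - (m : ℕ))‖ ^ 2 =
        2 * ∑ n : Fin (2 * M + 1), ∑ m : Fin (2 * M + 1), ‖a ((n : ℕ) - (m : ℕ))‖ ^ 2 +
        2 * ∑ n : Fin (2 * M + 1), ∑ m : Fin (2 * M + 1), ‖c M ((n : ℕ) - (m : ℕ))‖ ^ 2 := by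
      simp only [Finset.mul_sum, ← Finset.sum_add_distrib]
      refine Finset.sum_congr rfl fun n _ => Finset.sum_congr rfl fun m _ => ?_
      have := parallelogram_law_with_norm ℝ (a ((n : ℕ) - (m : ℕ))) (c M ((n : ℕ) - (m : ℕ)))
      linear_combination this
    have h4 : ∑ k ∈ s, (1 - |(k : ℝ)| / blockLength M) * ‖a k + c M k‖ ^ 2 =
        (∑ k ∈ s, (blockLength M - |(k : ℝ)|) * ‖a k + c M k‖ ^ 2) / blockLength M := by
      rw [Finset.sum_div]
      refine Finset.sum_congr rfl fun k _ => ?_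
      field_simp
    rw [h4, ← sub_nonneg]
    have h5 : 2 * I + 2 * ((∑ n : Fin (2 * M + 1), ∑ m : Fin (2 * M + 1),
        ‖c M ((n : ℕ) - (m : ℕ))‖ ^ 2) / blockLength M) -
        (∑ k ∈ s, (blockLength M - |(k : ℝ)|) * ‖a k + c M k‖ ^ 2) / blockLength M -
        (∑ n : Fin (2 * M + 1), ∑ m : Fin (2 * M + 1),
          ‖a ((n : ℕ) - (m : ℕ)) - c M ((n : ℕ) - (m : ℕ))‖ ^ 2) / blockLength M =
        (2 * (blockLength M * I) + 2 * (∑ n : Fin (2 * M + 1), ∑ m : Fin (2 * M + 1),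
        ‖c M ((n : ℕ) - (m : ℕ))‖ ^ 2) -
        (∑ k ∈ s, (blockLength M - |(k : ℝ)|) * ‖a k + c M k‖ ^ 2) -
        (∑ n : Fin (2 * M + 1), ∑ m : Fin (2 * M + 1),
          ‖a ((n : ℕ) - (m : ℕ)) - c M ((n : ℕ) - (m : ℕ))‖ ^ 2)) / blockLength M := by
      field_simp
    rw [h5]
    apply div_nonneg _ hN.le
    linarith
  have hlim : ∀ s : Finset ℤ, Tendsto (fun M : ℕ => 2 * I +
      2 * ((∑ n : Fin (2 * M + 1), ∑ m : Fin (2 * M + 1),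
        ‖c M ((n : ℕ) - (m : ℕ))‖ ^ 2) / blockLength M) -
      ∑ k ∈ s, (1 - |(k : ℝ)| / blockLength M) * ‖a k + c M k‖ ^ 2) atTop
      (𝓝 (2 * I + 2 * I - ∑ k ∈ s, (1 - 0) * ‖a k + a k‖ ^ 2)) := by
    intro s
    refine (tendsto_const_nhds.add (hn.const_mul 2)).sub (tendsto_finsetSum _ fun k _ => ?_)
    exact (tendsto_const_nhds.sub (tendsto_const_nhds.div_atTop tendsto_blockLength)).mul
      ((tendsto_const_nhds.add (hc k)).norm.pow 2)
  have hlimval : ∀ s : Finset ℤ, 2 * I + 2 * I - ∑ k ∈ s, (1 - 0) * ‖a k + a k‖ ^ 2 =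
      4 * (I - ∑ k ∈ s, ‖a k‖ ^ 2) := by
    intro s
    have : ∀ k, (1 - 0) * ‖a k + a k‖ ^ 2 = 4 * ‖a k‖ ^ 2 := by
      intro k
      rw [← two_mul, norm_mul, Complex.norm_ofNat]
      ring
    simp only [this, ← Finset.mul_sum]
    ring
  refine tendsto_order.2 ⟨fun x hx => .of_forall fun M => lt_of_lt_of_le hx ?_, fun ε hε => ?_⟩
  · exact div_nonneg (by positivity) (blockLength_pos M).le
  -- In the limit `a + c` becomes `2 a`, so the bound tends to four times the Parseval tail outside
  -- `s`; hence `ε / 4`.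
  · obtain ⟨s, hs⟩ := (ha.eventually (lt_mem_nhds (show I - ε / 4 < I by linarith))).exists
    have h1 := hlim s
    rw [hlimval] at h1
    filter_upwards [h1.eventually (gt_mem_nhds (show 4 * (I - ∑ k ∈ s, ‖a k‖ ^ 2) < ε by
      linarith))] with M hM
    exact (hbound s M).trans_lt hM

theorem abs_centred_div_lt (M : ℕ) (n : Fin (2 * M + 1)) :
    |(centred M n : ℝ) / blockLength M| < 1 / 2 := by
  have hN := blockLength_pos M
  have hn : ((n : ℕ) : ℝ) ≤ 2 * M := by
    have := n.2
    exact_mod_cast Nat.lt_succ_iff.1 this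
  have h0 : (0 : ℝ) ≤ ((n : ℕ) : ℝ) := by positivity
  rw [abs_div, abs_of_pos hN, div_lt_iff₀ hN, abs_lt]
  unfold blockLength centred
  push_cast
  constructor <;> linarith

variable {p G : ℝ → ℝ} {β T δ : ℝ}

theorem dftDiag_congr {d d' : ℤ → ℝ}
    (h : ∀ n : Fin (2 * M + 1), d (centred M n) = d' (centred M n)) :
    dftDiag M d = dftDiag M d' := by
  unfold dftDiag
  simp only [h]

theorem IsPulse.gramDFT_eq_core (hβ1 : β ≤ 1) (hT : 0 < T) (hδ : 0 < δ) (hδ1 : δ ≤ 1)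
    (hp : IsPulse p G β T) (M : ℕ) :
    gramDFT G δ T M = dftDiag M fun i => foldedCore G δ T (i / blockLength M) :=
  dftDiag_congr fun n => hp.foldedSpectrum_eq_core hβ1 hT hδ hδ1
    ((abs_centred_div_lt M n).trans (by norm_num))

/-- The Toeplitz matrix and its DFT form are asymptotically equivalent. -/
theorem IsPulse.tendsto_gram_sub_gramDFT (hβ1 : β ≤ 1) (hT : 0 < T) (hδ : 0 < δ) (hδ1 : δ ≤ 1)
    (hp : IsPulse p G β T) : Tendsto (fun M : ℕ =>
      (∑ m, ∑ n, ‖gram p δ T M m n - gramDFT G δ T M m n‖ ^ 2) / blockLength M)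
      atTop (𝓝 0) := by
  set F := foldedCore G δ T with hF
  have hmeas : Measurable F := hp.measurable_foldedCore δ
  have hae := hp.ae_continuousAt_foldedCore hT hδ
  have hbd := hp.norm_foldedCore_le hT hδ
  have hL2 : MemLp (fun f => (F f : ℂ)) 2 (volume.restrict (Set.Ioc (-(1 / 2)) (1 / 2))) := by
    refine MemLp.of_bound (C := 3 / δ) ?_ (.of_forall fun f => ?_)
    · exact (Complex.measurable_ofReal.comp hmeas).aestronglyMeasurable
    · rw [Complex.norm_real]; exact hbd f
  have hparseval := hasSum_sq_fourierCoeffOn neg_half_lt_half hL2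
  have hone : ((1 / 2 : ℝ) - -(1 / 2))⁻¹ = 1 := by norm_num
  rw [hone, one_smul] at hparseval
  have key := tendsto_toeplitz_sub
    (c := fun M => circCoeff M fun i => F (i / blockLength M)) hparseval ?_ ?_
  · refine key.congr fun M => ?_
    congr 1
    refine Finset.sum_congr rfl fun n _ => Finset.sum_congr rfl fun m _ => ?_
    rw [hp.gramDFT_eq_core hβ1 hT hδ hδ1, dftDiag_apply,
      hp.fourierCoeffOn_foldedCore hβ1 hT hδ hδ1]
    simp [gram, hF]
  · intro k
    rw [fourierCoeffOn_unit]
    have hexp : Continuous fun x : ℝ => Complex.exp (-(2 * Real.pi * Complex.I * k * x)) := by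
      fun_prop
    refine tendsto_riemannSum
      (F := fun x : ℝ => Complex.exp (-(2 * Real.pi * Complex.I * k * x)) * (F x : ℂ)) (C := 3 / δ) ?_ (fun x => ?_) ?_
    · exact (hexp.measurable.mul
        (Complex.measurable_ofReal.comp hmeas)).stronglyMeasurable
    · rw [norm_mul, Complex.norm_exp, Complex.norm_real]
      simpa using hbd x
    · filter_upwards [hae] with x hx
      exact hexp.continuousAt.mul
        (Complex.continuous_ofReal.continuousAt.comp hx)
  · have := tendsto_riemannSum (F := fun f => ‖(F f : ℂ)‖ ^ 2) (C := (3 / δ) ^ 2)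
      ?_ (fun x => ?_) ?_
    · refine this.congr fun M => ?_
      simp only [← dftDiag_apply]
      rw [sum_norm_sq_dftDiag, smul_eq_mul, div_mul_eq_mul_div, one_mul]
      congr 1
      refine Finset.sum_congr rfl fun n _ => ?_
      rw [Complex.norm_real, Real.norm_eq_abs, sq_abs]
    · simp only [Complex.norm_real]
      exact (hmeas.norm.pow_const 2).stronglyMeasurable
    · rw [norm_pow, norm_norm, Complex.norm_real]
      exact pow_le_pow_left₀ (norm_nonneg _) (hbd x) 2
    · filter_upwards [hae] with x hx
      simp only [Complex.norm_real]
      exact hx.norm.pow 2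

end Asymptotic

/-! ### Optimal inputs in the two regimes. -/

section Optimality

variable {p G : ℝ → ℝ} {β T δ : ℝ}

/-- The samples lie strictly inside `|f| < 1/2`, hence strictly inside the scaled band, where the
unshifted replica is positive. Strictness matters when `δ (1 + β) = 1`, as then all replicas vanish
at `±1/2`. -/
theorem IsPulse.gramDFT_posDef (hβ1 : β ≤ 1) (hT : 0 < T) (hδ : 0 < δ) (hδ1 : δ ≤ 1)
    (hp : IsPulse p G β T) (hw : 1 ≤ δ * (1 + β)) (M : ℕ) : (gramDFT G δ T M).PosDef := by
  rw [hp.gramDFT_eq_core hβ1 hT hδ hδ1]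
  refine dftDiag_posDef fun n => ?_
  have h0 := hp.scaled_pos hT hδ
    (u := (centred M n : ℝ) / blockLength M) (by linarith [abs_centred_div_lt M n])
  have h1 := hp.nonneg (((centred M n : ℝ) / blockLength M + 1) / (δ * T))
  have h2 := hp.nonneg (((centred M n : ℝ) / blockLength M - 1) / (δ * T))
  unfold foldedCore
  positivity

theorem IsPulse.foldedSpectrum_nonneg (hT : 0 < T) (hδ : 0 < δ) (hp : IsPulse p G β T) (f : ℝ) :
    0 ≤ foldedSpectrum G δ T f :=
  mul_nonneg (by positivity) (tsum_nonneg fun _ => hp.nonneg _)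

section SmallAcceleration

/-- For small acceleration the shifted spectra do not overlap. -/
theorem IsPulse.foldedSpectrum_eq (hβ1 : β ≤ 1) (hT : 0 < T) (hδ : 0 < δ) (hδ1 : δ ≤ 1)
    (hp : IsPulse p G β T) (hw : δ * (1 + β) < 1) {f : ℝ} (hf : |f| ≤ 1 / 2) :
    foldedSpectrum G δ T f = 1 / (δ * T) * G (f / (δ * T)) := by
  obtain ⟨h1, h2⟩ := abs_le.1 hf
  rw [hp.foldedSpectrum_eq_core hβ1 hT hδ hδ1 (hf.trans_lt (by norm_num)), foldedCore,
    hp.scaled_eq_zero hT hδ (u := f + 1) (le_abs.2 (.inl (by linarith))),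
    hp.scaled_eq_zero hT hδ (u := f - 1) (le_abs.2 (.inr (by linarith)))]
  ring

theorem IsPulse.foldedSpectrum_eq_zero (hβ1 : β ≤ 1) (hT : 0 < T) (hδ : 0 < δ) (hδ1 : δ ≤ 1)
    (hp : IsPulse p G β T) (hw : δ * (1 + β) < 1) {f : ℝ} (hf : |f| ≤ 1 / 2)
    (hfw : δ * (1 + β) / 2 ≤ |f|) : foldedSpectrum G δ T f = 0 := by
  rw [hp.foldedSpectrum_eq hβ1 hT hδ hδ1 hw hf, hp.scaled_eq_zero hT hδ hfw, mul_zero]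

theorem IsPulse.phi_mul_foldedSpectrum (hβ0 : 0 ≤ β) (hβ1 : β ≤ 1) (hT : 0 < T) (hδ : 0 < δ)
    (hδ1 : δ ≤ 1) (hp : IsPulse p G β T) (hw : δ * (1 + β) < 1) {f : ℝ} (hf : |f| ≤ 1 / 2) :
    phi G β δ T f * foldedSpectrum G δ T f =
      if |f| < δ * (1 + β) / 2 then 1 / (δ * (1 + β)) else 0 := by
  unfold phi
  split_ifs with h
  · have hG := (hp.scaled_pos hT hδ h).ne'
    have hb : 1 + β ≠ 0 := by positivity
    rw [hp.foldedSpectrum_eq hβ1 hT hδ hδ1 hw hf]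
    generalize G (f / (δ * T)) = g at hG
    field_simp
  · rw [zero_mul]

theorem IsPulse.phi_nonneg (hβ0 : 0 ≤ β) (hT : 0 < T) (hp : IsPulse p G β T) (f : ℝ) :
    0 ≤ phi G β δ T f := by
  unfold phi
  split_ifs
  · have := hp.nonneg (f / (δ * T))
    positivity
  · rfl

theorem IsPulse.measurable_phi (hp : IsPulse p G β T) (δ : ℝ) : Measurable (phi G β δ T) := by
  have := hp.measurable
  unfold phi
  exact Measurable.ite (isOpen_band _).measurableSet (by fun_prop) measurable_const

/-- The nonzero samples are those with `|i| < x`, that is `|i| ≤ ⌈x⌉ - 1`. -/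
theorem IsPulse.numNonzero_eq (hβ0 : 0 ≤ β) (hT : 0 < T) (hδ : 0 < δ)
    (hp : IsPulse p G β T) (hw : δ * (1 + β) < 1) (M : ℕ) :
    (numNonzero G δ T M : ℤ) = 2 * ⌈blockLength M * (δ * (1 + β) / 2)⌉ - 1 := by
  have hN := blockLength_pos M
  set x := blockLength M * (δ * (1 + β) / 2) with hx
  have hx0 : 0 < x := by positivity
  -- Hence `⌈x⌉ - 1 ≤ M`: the index range `-M, …, M` cuts off no nonzero sample.
  have hxM : x ≤ ((M + 1 : ℤ) : ℝ) := by
    have : x ≤ blockLength M * (1 / 2) := by rw [hx]; gcongr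
    refine this.trans ?_
    unfold blockLength
    push_cast
    linarith
  have hc0 : 0 < ⌈x⌉ := Int.ceil_pos.2 hx0
  have hcM : ⌈x⌉ ≤ M + 1 := Int.ceil_le.2 hxM
  have hset : ((Finset.Icc (-(M : ℤ)) M).filter fun i : ℤ =>
      G (i / (blockLength M * δ * T)) ≠ 0) = Finset.Icc (-(⌈x⌉ - 1)) (⌈x⌉ - 1) := by
    classical
    ext i
    have hi : G (i / (blockLength M * δ * T)) ≠ 0 ↔ -(⌈x⌉ - 1) ≤ i ∧ i ≤ ⌈x⌉ - 1 := by
      have h1 : (i : ℝ) / (blockLength M * δ * T) = i / blockLength M / (δ * T) := by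
        rw [div_div, mul_assoc]
      have h2 : G (i / (blockLength M * δ * T)) ≠ 0 ↔ |(i : ℝ) / blockLength M| <
          δ * (1 + β) / 2 := by
        rw [h1]
        constructor
        · intro h
          by_contra! hcon
          exact h (hp.scaled_eq_zero hT hδ hcon)
        · exact fun h => (hp.scaled_pos hT hδ h).ne'
      rw [h2, abs_div, abs_of_pos hN, div_lt_iff₀ hN, mul_comm, ← hx, ← Int.cast_abs,
        ← Int.lt_ceil, abs_lt]
      omega
    simp only [Finset.mem_filter, Finset.mem_Icc]
    rw [hi]
    omega
  -- In `numNonzero` the filtered index is real and the integer interval is cast elementwise; the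
  -- cast is injective, so the count is the same.
  have hcard : numNonzero G δ T M = ((Finset.Icc (-(M : ℤ)) M).filter fun i : ℤ =>
      G (i / (blockLength M * δ * T)) ≠ 0).card := by
    classical
    rw [← Finset.card_map ⟨((↑) : ℤ → ℝ), Int.cast_injective⟩]
    unfold numNonzero
    congr 1
    ext r
    simp only [Finset.bind_def, Finset.pure_def, Finset.mem_filter, Finset.mem_sup,
      Finset.mem_singleton, Finset.mem_map, Function.Embedding.coeFn_mk]
    constructor
    · rintro ⟨⟨i, hi, rfl⟩, hr⟩
      exact ⟨i, ⟨hi, hr⟩, rfl⟩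
    · rintro ⟨i, ⟨hi, hr⟩, rfl⟩
      exact ⟨⟨i, hi, rfl⟩, hr⟩
  rw [hcard, hset, Int.card_Icc]
  omega

/-- The eigenvalues of the covariance matrix are samples of the spectrum. -/
theorem IsPulse.lamTilde_eq_phi (hβ0 : 0 ≤ β) (hT : 0 < T) (hδ : 0 < δ)
    (hp : IsPulse p G β T) (hw : δ * (1 + β) < 1) (M : ℕ) (i : ℤ) :
    lamTilde G β δ T M i = phi G β δ T (i / blockLength M) := by
  have hN := blockLength_pos M
  have hZ := hp.numNonzero_eq hβ0 hT hδ hw M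
  -- `Z / 2 = ⌈x⌉ - 1/2`, so for an integer the conditions `|i| < Z / 2`, `|i| < ⌈x⌉` and `|i| < x`
  -- coincide.
  have hiff : |(i : ℝ)| < (numNonzero G δ T M : ℝ) / 2 ↔
      |(i : ℝ) / blockLength M| < δ * (1 + β) / 2 := by
    rw [abs_div, abs_of_pos hN, div_lt_iff₀ hN, mul_comm (δ * (1 + β) / 2), ← Int.cast_abs,
      lt_div_iff₀ two_pos, ← Int.lt_ceil (a := blockLength M * (δ * (1 + β) / 2))]
    have h1 : ((|i| : ℤ) : ℝ) * 2 < (numNonzero G δ T M : ℝ) ↔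
        |i| * 2 < (numNonzero G δ T M : ℤ) := by
      exact_mod_cast Iff.rfl
    rw [h1, hZ]
    omega
  unfold lamTilde phi
  simp only [hiff]
  rw [div_div, mul_assoc (blockLength M)]

/-- Symbol energy density of the optimal input, seen at the receiver. -/
def bandDensity (β δ E f : ℝ) : ℝ :=
  if |f| < δ * (1 + β) / 2 then E / (δ * (1 + β)) else 0

theorem measurable_bandDensity (β δ E : ℝ) : Measurable (bandDensity β δ E) :=
  Measurable.ite (isOpen_band _).measurableSet measurable_const measurable_const

theorem bandDensity_nonneg {E : ℝ} (hβ0 : 0 ≤ β) (hδ : 0 < δ) (hE : 0 ≤ E) (f : ℝ) :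
    0 ≤ bandDensity β δ E f := by
  unfold bandDensity
  split_ifs <;> positivity

theorem bandDensity_le {E : ℝ} (hβ0 : 0 ≤ β) (hδ : 0 < δ) (hE : 0 ≤ E) (f : ℝ) :
    bandDensity β δ E f ≤ E / (δ * (1 + β)) := by
  unfold bandDensity
  split_ifs
  · rfl
  · positivity

theorem integral_bandDensity (hβ0 : 0 ≤ β) (hδ : 0 < δ) (hw : δ * (1 + β) < 1) (E : ℝ) :
    ∫ f in Set.Icc (-(1 / 2 : ℝ)) (1 / 2), bandDensity β δ E f = E := by
  have h1 : bandDensity β δ E = Set.indicator (Set.Ioo (-(δ * (1 + β) / 2)) (δ * (1 + β) / 2))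
      fun _ => E / (δ * (1 + β)) := by
    classical
    ext f
    rw [Set.indicator_apply]
    simp only [bandDensity, Set.mem_Ioo, abs_lt]
  have hsub : Set.Icc (-(1 / 2 : ℝ)) (1 / 2) ∩
      Set.Ioo (-(δ * (1 + β) / 2)) (δ * (1 + β) / 2) =
        Set.Ioo (-(δ * (1 + β) / 2)) (δ * (1 + β) / 2) := by
    refine Set.inter_eq_self_of_subset_right fun f hf => ?_
    exact ⟨by linarith [hf.1], by linarith [hf.2]⟩
  have hpos : 0 < δ * (1 + β) := by positivity
  rw [h1, setIntegral_indicator measurableSet_Ioo, hsub, setIntegral_const,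
    Real.volume_real_Ioo_of_le (by linarith), smul_eq_mul]
  field_simp
  ring

theorem integrableOn_bandDensity {E : ℝ} (hβ0 : 0 ≤ β) (hδ : 0 < δ) (hE : 0 ≤ E) :
    IntegrableOn (bandDensity β δ E) (Set.Icc (-(1 / 2 : ℝ)) (1 / 2)) := by
  refine Measure.integrableOn_of_bounded (M := E / (δ * (1 + β))) (by simp)
    (measurable_bandDensity β δ E).aestronglyMeasurable (.of_forall fun f => ?_)
  rw [Real.norm_of_nonneg (bandDensity_nonneg hβ0 hδ hE f)]
  exact bandDensity_le hβ0 hδ hE f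

theorem ae_continuousAt_bandDensity (β δ E : ℝ) :
    ∀ᵐ f : ℝ, ContinuousAt (bandDensity β δ E) f := by
  have hfin : {f : ℝ | |f| = δ * (1 + β) / 2}.Finite := by
    refine (Set.toFinite {δ * (1 + β) / 2, -(δ * (1 + β) / 2)}).subset fun f hf => ?_
    exact eq_or_eq_neg_of_abs_eq hf
  filter_upwards [hfin.countable.ae_notMem volume] with f hf
  rcases lt_or_gt_of_ne (show |f| ≠ δ * (1 + β) / 2 from hf) with h | h
  · have : bandDensity β δ E =ᶠ[𝓝 f] fun _ => E / (δ * (1 + β)) := by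
      filter_upwards [(isOpen_band _).mem_nhds h] with x hx
      exact if_pos hx
    exact continuousAt_const.congr this.symm
  · have : bandDensity β δ E =ᶠ[𝓝 f] fun _ => 0 := by
      filter_upwards [(isOpen_lt continuous_const continuous_abs).mem_nhds h] with x hx
      exact if_neg (not_lt.2 (le_of_lt hx))
    exact continuousAt_const.congr this.symm

theorem IsPulse.mul_phi_mul_foldedSpectrum (hβ0 : 0 ≤ β) (hβ1 : β ≤ 1) (hT : 0 < T) (hδ : 0 < δ)
    (hδ1 : δ ≤ 1) (hp : IsPulse p G β T) (hw : δ * (1 + β) < 1) (E : ℝ) {f : ℝ}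
    (hf : |f| ≤ 1 / 2) :
    E * phi G β δ T f * foldedSpectrum G δ T f = bandDensity β δ E f := by
  rw [mul_assoc, hp.phi_mul_foldedSpectrum hβ0 hβ1 hT hδ hδ1 hw hf]
  unfold bandDensity
  split_ifs <;> ring

/-! ### Optimal power spectra. -/

section Spectrum

variable {c e : ℝ}

theorem logb_one_add_mul_nonneg (hc : 0 < c) {x : ℝ} (hx : 0 ≤ x) : 0 ≤ Real.logb 2 (1 + c * x) :=
  Real.logb_nonneg one_lt_two (by nlinarith)

/-- `log (1 + c u) ≤ c u`, so finite energy gives a finite rate; otherwise the integral would take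
the default value `0` and comparisons would mean nothing. -/
theorem integrable_logb {α : Type*} [MeasurableSpace α] {μ : Measure α} (hc : 0 < c)
    {u : α → ℝ} (hu : Integrable u μ) (hu0 : ∀ᵐ x ∂μ, 0 ≤ u x) :
    Integrable (fun x => Real.logb 2 (1 + c * u x)) μ := by
  refine (hu.const_mul (c / Real.log 2)).mono' ?_ ?_
  · simp only [Real.logb]
    have h1 : AEStronglyMeasurable (fun x => 1 + c * u x) μ :=
      aestronglyMeasurable_const.add (hu.1.const_mul c)
    exact ((Real.measurable_log.comp_aemeasurable h1.aemeasurable).div_const _).aestronglyMeasurable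
  · filter_upwards [hu0] with x hx
    rw [Real.norm_of_nonneg (logb_one_add_mul_nonneg hc hx), Real.logb, div_mul_eq_mul_div]
    have h1 := log_one_add_mul_le hc le_rfl hx
    have h2 := Real.log_pos one_lt_two
    gcongr
    simpa using h1

/-- Among densities that vanish off a set, the rate is maximal, at given energy, for the density
that is constant on the set. -/
theorem integral_logb_le {α : Type*} [MeasurableSpace α] {μ : Measure α} (hc : 0 < c) (he : 0 ≤ e)
    {u v : α → ℝ} (hu : Integrable u μ) (hv : Integrable v μ) (hu0 : ∀ᵐ x ∂μ, 0 ≤ u x)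
    (hv0 : ∀ᵐ x ∂μ, 0 ≤ v x) (huv : ∀ᵐ x ∂μ, v x = e ∨ u x = v x)
    (hle : ∫ x, u x ∂μ ≤ ∫ x, v x ∂μ) :
    ∫ x, Real.logb 2 (1 + c * u x) ∂μ ≤ ∫ x, Real.logb 2 (1 + c * v x) ∂μ ∧
      (∫ x, Real.logb 2 (1 + c * v x) ∂μ ≤ ∫ x, Real.logb 2 (1 + c * u x) ∂μ →
        ∀ᵐ x ∂μ, u x = v x) := by
  set K := c / (1 + c * e) / Real.log 2 with hK
  have hl := Real.log_pos one_lt_two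
  have hK0 : 0 ≤ K := by positivity
  have hiu := integrable_logb hc hu hu0
  have hiv := integrable_logb hc hv hv0
  -- `D` is the gap in the tangent inequality. It is nonnegative, its integral bounds the rate
  -- difference, and if that integral is zero, strictness of the tangent inequality gives `u = v`
  -- almost everywhere.
  set D : α → ℝ := fun x => Real.logb 2 (1 + c * v x) + K * (u x - v x) -
    Real.logb 2 (1 + c * u x) with hD
  have hDint : Integrable D μ := (hiv.add ((hu.sub hv).const_mul K)).sub hiu
  have hD0 : ∀ᵐ x ∂μ, 0 ≤ D x := by
    filter_upwards [hu0, huv] with x hx hxe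
    rcases hxe with h | h
    · simp only [hD, hK, h, Real.logb]
      have h1 := div_le_div_of_nonneg_right (log_one_add_mul_le hc he hx) hl.le
      rw [add_div] at h1
      have h2 : c / (1 + c * e) * (u x - e) / Real.log 2 =
        c / (1 + c * e) / Real.log 2 * (u x - e) := by ring
      linarith
    · simp [hD, h]
  have hDI : ∫ x, D x ∂μ = ∫ x, Real.logb 2 (1 + c * v x) ∂μ +
      K * (∫ x, u x ∂μ - ∫ x, v x ∂μ) - ∫ x, Real.logb 2 (1 + c * u x) ∂μ := by
    have huv' : Integrable (fun x => K * (u x - v x)) μ := (hu.sub hv).const_mul K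
    rw [← integral_sub hu hv, ← integral_const_mul, ← integral_add hiv huv',
      ← integral_sub (f := fun x => Real.logb 2 (1 + c * v x) + K * (u x - v x))
        (hiv.add huv') hiu]
  have hneg : K * (∫ x, u x ∂μ - ∫ x, v x ∂μ) ≤ 0 :=
    mul_nonpos_of_nonneg_of_nonpos hK0 (by linarith)
  have hDI0 := integral_nonneg_of_ae hD0
  refine ⟨by linarith, fun hge => ?_⟩
  have hz : ∫ x, D x ∂μ = 0 := le_antisymm (by linarith) hDI0
  filter_upwards [(integral_eq_zero_iff_of_nonneg_ae hD0 hDint).1 hz, hu0, huv] with x hx hx0 hxe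
  rcases hxe with h | h
  · by_contra hne
    rw [h] at hne
    simp only [hD, hK, h, Real.logb, Pi.zero_apply] at hx
    have h1 := div_lt_div_of_pos_right (log_one_add_mul_lt hc he hx0 hne) hl
    rw [add_div] at h1
    have h2 : c / (1 + c * e) * (u x - e) / Real.log 2 =
      c / (1 + c * e) / Real.log 2 * (u x - e) := by ring
    linarith
  · exact h

theorem abs_le_half_of_mem {f : ℝ} (hf : f ∈ Set.Icc (-(1 / 2 : ℝ)) (1 / 2)) : |f| ≤ 1 / 2 :=
  abs_le.2 hf

variable {h : ℂ} {σ E : ℝ}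

theorem IsPulse.energy_phi (hβ0 : 0 ≤ β) (hβ1 : β ≤ 1) (hT : 0 < T) (hδ : 0 < δ)
    (hδ1 : δ ≤ 1) (hp : IsPulse p G β T) (hw : δ * (1 + β) < 1) (E : ℝ) :
    spectralEnergy G δ T (fun f => E * phi G β δ T f) = E := by
  unfold spectralEnergy
  rw [setIntegral_congr_fun measurableSet_Icc fun f hf =>
    hp.mul_phi_mul_foldedSpectrum hβ0 hβ1 hT hδ hδ1 hw E (abs_le_half_of_mem hf)]
  exact integral_bandDensity hβ0 hδ hw E

theorem IsPulse.isInputSpectrum_phi (hβ0 : 0 ≤ β) (hβ1 : β ≤ 1) (hT : 0 < T) (hδ : 0 < δ)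
    (hδ1 : δ ≤ 1) (hp : IsPulse p G β T) (hw : δ * (1 + β) < 1) (hE : 0 ≤ E) :
    IsInputSpectrum G δ T (fun f => E * phi G β δ T f) where
  measurable := (hp.measurable_phi δ).const_mul E
  nonneg f := mul_nonneg hE (hp.phi_nonneg hβ0 hT f)
  finite_energy := (integrableOn_bandDensity hβ0 hδ hE).congr_fun (fun _ hf =>
    (hp.mul_phi_mul_foldedSpectrum hβ0 hβ1 hT hδ hδ1 hw E (abs_le_half_of_mem hf)).symm)
      measurableSet_Icc

theorem IsPulse.spectralRate_le (hβ0 : 0 ≤ β) (hβ1 : β ≤ 1) (hT : 0 < T) (hδ : 0 < δ)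
    (hδ1 : δ ≤ 1) (hp : IsPulse p G β T) (hw : δ * (1 + β) < 1) (hE : 0 ≤ E) (hh : h ≠ 0)
    (hσ : 0 < σ) {s : ℝ → ℝ} (hs : IsInputSpectrum G δ T s)
    (hle : spectralEnergy G δ T s ≤ E) :
    spectralRate G δ T h σ s ≤ spectralRate G δ T h σ (fun f => E * phi G β δ T f) ∧
      (spectralRate G δ T h σ (fun f => E * phi G β δ T f) ≤ spectralRate G δ T h σ s →
        ∀ᵐ f ∂(volume.restrict (Set.Icc (-(1 / 2 : ℝ)) (1 / 2))),
          s f * foldedSpectrum G δ T f = E * phi G β δ T f * foldedSpectrum G δ T f) := by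
  have hs' := hp.isInputSpectrum_phi hβ0 hβ1 hT hδ hδ1 hw hE
  refine integral_logb_le (e := E / (δ * (1 + β))) (by positivity) (by positivity)
    hs.finite_energy hs'.finite_energy
    (.of_forall fun f => mul_nonneg (hs.nonneg f) (hp.foldedSpectrum_nonneg hT hδ f))
    (.of_forall fun f => mul_nonneg (hs'.nonneg f) (hp.foldedSpectrum_nonneg hT hδ f)) ?_ ?_
  · refine (ae_restrict_iff' measurableSet_Icc).2 (.of_forall fun f hf => ?_)
    rcases lt_or_ge |f| (δ * (1 + β) / 2) with hlt | hge
    · left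
      rw [hp.mul_phi_mul_foldedSpectrum hβ0 hβ1 hT hδ hδ1 hw E (abs_le_half_of_mem hf)]
      exact if_pos hlt
    · right
      rw [hp.foldedSpectrum_eq_zero hβ1 hT hδ hδ1 hw (abs_le_half_of_mem hf) hge, mul_zero,
        mul_zero]
  · have := hp.energy_phi hβ0 hβ1 hT hδ hδ1 hw E
    unfold spectralEnergy at this hle
    rw [this]
    exact hle

theorem IsPulse.isOptimalSpectrum_phi (hβ0 : 0 ≤ β) (hβ1 : β ≤ 1) (hT : 0 < T) (hδ : 0 < δ)
    (hδ1 : δ ≤ 1) (hp : IsPulse p G β T) (hw : δ * (1 + β) < 1) (hE : 0 ≤ E) (hh : h ≠ 0)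
    (hσ : 0 < σ) :
    IsOptimalSpectrum G δ T h σ (snrRx T σ E) (fun f => E * phi G β δ T f) :=
  ⟨hp.isInputSpectrum_phi hβ0 hβ1 hT hδ hδ1 hw hE,
    by rw [hp.energy_phi hβ0 hβ1 hT hδ hδ1 hw E],
    fun _ hs hle => (hp.spectralRate_le hβ0 hβ1 hT hδ hδ1 hw hE hh hσ hs
      ((snrRx_le_iff hT hσ).1 hle)).1⟩

theorem IsOptimalSpectrum.ae_eq_phi (hβ0 : 0 ≤ β) (hβ1 : β ≤ 1) (hT : 0 < T) (hδ : 0 < δ)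
    (hδ1 : δ ≤ 1) (hp : IsPulse p G β T) (hw : δ * (1 + β) < 1) (hE : 0 ≤ E) (hh : h ≠ 0)
    (hσ : 0 < σ) {s : ℝ → ℝ} (hs : IsOptimalSpectrum G δ T h σ (snrRx T σ E) s) :
    ∀ᵐ f ∂(volume.restrict (Set.Icc (-(1 / 2 : ℝ)) (1 / 2))),
      s f * foldedSpectrum G δ T f = E * phi G β δ T f * foldedSpectrum G δ T f :=
  (hp.spectralRate_le hβ0 hβ1 hT hδ hδ1 hw hE hh hσ hs.1
    ((snrRx_le_iff hT hσ).1 hs.2.1.le)).2 (hs.2.2 _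
      (hp.isInputSpectrum_phi hβ0 hβ1 hT hδ hδ1 hw hE)
      (by rw [hp.energy_phi hβ0 hβ1 hT hδ hδ1 hw E]))

end Spectrum

/-! ### Covariance matrices for the DFT form under small acceleration. -/

section Covariance

open Matrix

variable {h : ℂ} {σ E : ℝ} {M : ℕ}

theorem IsPulse.covSmall_eq (hβ0 : 0 ≤ β) (hT : 0 < T) (hδ : 0 < δ)
    (hp : IsPulse p G β T) (hw : δ * (1 + β) < 1) (E : ℝ) (M : ℕ) :
    covSmall G β (E / (δ * T)) δ T M = dftDiag M fun i => E * phi G β δ T (i / blockLength M) := by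
  have hcoef : E / (δ * T) * δ * T = E := by field_simp
  unfold covSmall dftDiag
  rw [hcoef, ← Matrix.smul_mul, ← Matrix.mul_smul]
  congr 2
  ext i j
  rcases eq_or_ne i j with rfl | hij
  · simp [hp.lamTilde_eq_phi hβ0 hT hδ hw]
  · simp [hij]

/-- Each sample in the band contributes `E / (δ (1 + β))`, so the energy is `Z / N` times this and
in general differs from `E`. This is why optimality at finite length is stated at the SNR that the
matrix has. -/
theorem IsPulse.traceEnergy_covSmall (hβ0 : 0 ≤ β) (hβ1 : β ≤ 1) (hT : 0 < T) (hδ : 0 < δ)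
    (hδ1 : δ ≤ 1) (hp : IsPulse p G β T) (hw : δ * (1 + β) < 1) (E : ℝ) (M : ℕ) :
    traceEnergy (gramDFT G δ T M) (covSmall G β (E / (δ * T)) δ T M) =
      (1 / blockLength M) • ∑ n : Fin (2 * M + 1),
        bandDensity β δ E (centred M n / blockLength M) := by
  unfold traceEnergy
  rw [hp.covSmall_eq hβ0 hT hδ hw, gramDFT, dftDiag_mul, trace_dftDiag, Complex.ofReal_re,
    smul_eq_mul, one_div, inv_mul_eq_div]
  congr 1
  exact Finset.sum_congr rfl fun n _ =>
    hp.mul_phi_mul_foldedSpectrum hβ0 hβ1 hT hδ hδ1 hw E (abs_centred_div_lt M n).le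

theorem IsPulse.tendsto_traceEnergy_covSmall (hβ0 : 0 ≤ β) (hβ1 : β ≤ 1) (hT : 0 < T)
    (hδ : 0 < δ) (hδ1 : δ ≤ 1) (hp : IsPulse p G β T) (hw : δ * (1 + β) < 1) (hE : 0 ≤ E) :
    Tendsto (fun M : ℕ => traceEnergy (gramDFT G δ T M) (covSmall G β (E / (δ * T)) δ T M))
      atTop (𝓝 E) := by
  simp only [hp.traceEnergy_covSmall hβ0 hβ1 hT hδ hδ1 hw]
  have h1 := tendsto_riemannSum (F := bandDensity β δ E) (C := E / (δ * (1 + β)))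
    (measurable_bandDensity β δ E).stronglyMeasurable (fun x => by
      rw [Real.norm_of_nonneg (bandDensity_nonneg hβ0 hδ hE x)]
      exact bandDensity_le hβ0 hδ hE x) (ae_continuousAt_bandDensity β δ E)
  rwa [intervalIntegral.integral_of_le neg_half_lt_half.le, ← integral_Icc_eq_integral_Ioc,
    integral_bandDensity hβ0 hδ hw] at h1

theorem IsPulse.covSmall_posSemidef (hβ0 : 0 ≤ β) (hT : 0 < T) (hδ : 0 < δ)
    (hp : IsPulse p G β T) (hw : δ * (1 + β) < 1) (hE : 0 ≤ E) (M : ℕ) :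
    (covSmall G β (E / (δ * T)) δ T M).PosSemidef := by
  rw [hp.covSmall_eq hβ0 hT hδ hw]
  exact dftDiag_posSemidef fun i => mul_nonneg hE (hp.phi_nonneg hβ0 hT _)

/-- After the factor of the channel matrix the input `covSmall` is white. -/
theorem IsPulse.covSmall_white (hβ0 : 0 ≤ β) (hβ1 : β ≤ 1) (hT : 0 < T)
    (hδ : 0 < δ) (hδ1 : δ ≤ 1) (hp : IsPulse p G β T) (hw : δ * (1 + β) < 1) (E : ℝ) (M : ℕ) :
    dftFactor M (fun i => foldedSpectrum G δ T (i / blockLength M)) *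
      covSmall G β (E / (δ * T)) δ T M *
        (dftFactor M fun i => foldedSpectrum G δ T (i / blockLength M))ᴴ =
          ((E / (δ * (1 + β)) : ℝ) : ℂ) • 1 := by
  rw [hp.covSmall_eq hβ0 hT hδ hw]
  refine dftFactor_mul_dftDiag_mul (fun i => hp.foldedSpectrum_nonneg hT hδ _) fun n hn => ?_
  have hle := (abs_centred_div_lt M n).le
  rw [mul_comm, hp.mul_phi_mul_foldedSpectrum hβ0 hβ1 hT hδ hδ1 hw E hle]
  refine if_pos (lt_of_not_ge fun hge => hn ?_)
  exact hp.foldedSpectrum_eq_zero hβ1 hT hδ hδ1 hw hle hge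

theorem IsPulse.gramDFT_eq_factor (hT : 0 < T) (hδ : 0 < δ) (hp : IsPulse p G β T) (M : ℕ) :
    gramDFT G δ T M = (dftFactor M fun i => foldedSpectrum G δ T (i / blockLength M))ᴴ *
      dftFactor M fun i => foldedSpectrum G δ T (i / blockLength M) :=
  (conjTranspose_dftFactor_mul fun _ => hp.foldedSpectrum_nonneg hT hδ _).symm

theorem IsPulse.isOptimalCov_covSmall (hβ0 : 0 ≤ β) (hβ1 : β ≤ 1) (hT : 0 < T)
    (hδ : 0 < δ) (hδ1 : δ ≤ 1) (hp : IsPulse p G β T) (hw : δ * (1 + β) < 1) (hE : 0 ≤ E)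
    (hh : h ≠ 0) (hσ : 0 < σ) (M : ℕ) :
    IsOptimalCov (infoRate h σ (gramDFT G δ T M))
      (fun S => snrRx T σ (traceEnergy (gramDFT G δ T M) S))
      (snrRx T σ (traceEnergy (gramDFT G δ T M) (covSmall G β (E / (δ * T)) δ T M)))
      (covSmall G β (E / (δ * T)) δ T M) := by
  rw [hp.gramDFT_eq_factor hT hδ]
  exact isOptimalCov_of_white hT hh hσ (by positivity)
    (hp.covSmall_white hβ0 hβ1 hT hδ hδ1 hw E M) (hp.covSmall_posSemidef hβ0 hT hδ hw hE M)

/-- Optimality fixes `C S Cᴴ`, and multiplying by `Cᴴ` and `C` gives `A S A`; the parts of `S` that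
meet the kernel of `A` remain free. -/
theorem IsOptimalCov.gramDFT_mul_mul_eq (hβ0 : 0 ≤ β) (hβ1 : β ≤ 1) (hT : 0 < T)
    (hδ : 0 < δ) (hδ1 : δ ≤ 1) (hp : IsPulse p G β T) (hw : δ * (1 + β) < 1) (hE : 0 ≤ E)
    (hh : h ≠ 0) (hσ : 0 < σ) {S : BlockMatrix M}
    (hS : IsOptimalCov (infoRate h σ (gramDFT G δ T M))
      (fun S => snrRx T σ (traceEnergy (gramDFT G δ T M) S))
      (snrRx T σ (traceEnergy (gramDFT G δ T M) (covSmall G β (E / (δ * T)) δ T M))) S) :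
    gramDFT G δ T M * S * gramDFT G δ T M =
      gramDFT G δ T M * covSmall G β (E / (δ * T)) δ T M * gramDFT G δ T M := by
  have hwhite := hp.covSmall_white hβ0 hβ1 hT hδ hδ1 hw E M
  rw [hp.gramDFT_eq_factor hT hδ] at hS ⊢
  have h1 := hS.white hT hh hσ (by positivity) hwhite (hp.covSmall_posSemidef hβ0 hT hδ hw hE M)
  set C := dftFactor M fun i => foldedSpectrum G δ T (i / blockLength M)
  have h2 : ∀ X : BlockMatrix M, Cᴴ * C * X * (Cᴴ * C) = Cᴴ * (C * X * Cᴴ) * C := fun X => by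
    simp only [Matrix.mul_assoc]
  rw [h2, h2, h1, hwhite]

/-- The white level, and with it the tangent slope `K`, is the same for all `M`; the possible excess
is at most `K` times an energy defect that tends to zero. -/
theorem IsPulse.eventually_infoRate_le (hβ0 : 0 ≤ β) (hβ1 : β ≤ 1) (hT : 0 < T)
    (hδ : 0 < δ) (hδ1 : δ ≤ 1) (hp : IsPulse p G β T) (hw : δ * (1 + β) < 1) (hE : 0 ≤ E)
    (hh : h ≠ 0) (hσ : 0 < σ) {ε : ℝ} (hε : 0 < ε) :
    ∀ᶠ M : ℕ in atTop, ∀ S : BlockMatrix M, S.PosSemidef →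
      traceEnergy (gramDFT G δ T M) S ≤ E → infoRate h σ (gramDFT G δ T M) S ≤
        infoRate h σ (gramDFT G δ T M) (covSmall G β (E / (δ * T)) δ T M) + ε := by
  set K := ‖h‖ ^ 2 / σ ^ 2 / (1 + ‖h‖ ^ 2 / σ ^ 2 * (E / (δ * (1 + β)))) / Real.log 2 with hK
  have hl := Real.log_pos one_lt_two
  have hK0 : 0 ≤ K := by positivity
  have hlim : Tendsto (fun M : ℕ => K * (E - traceEnergy (gramDFT G δ T M)
      (covSmall G β (E / (δ * T)) δ T M))) atTop (𝓝 (K * (E - E))) :=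
    (tendsto_const_nhds.sub
      (hp.tendsto_traceEnergy_covSmall hβ0 hβ1 hT hδ hδ1 hw hE)).const_mul K
  rw [sub_self, mul_zero] at hlim
  filter_upwards [hlim.eventually (gt_mem_nhds hε)] with M hM S hS hle
  have hwhite := hp.covSmall_white hβ0 hβ1 hT hδ hδ1 hw E M
  rw [hp.gramDFT_eq_factor hT hδ] at hM hle ⊢
  refine (infoRate_le_tangent hh hσ (by positivity) hwhite hS).trans ?_
  rw [← hK]
  have := mul_le_mul_of_nonneg_left (sub_le_sub_right hle (traceEnergy
    ((dftFactor M fun i => foldedSpectrum G δ T (i / blockLength M))ᴴ *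
      dftFactor M fun i => foldedSpectrum G δ T (i / blockLength M))
        (covSmall G β (E / (δ * T)) δ T M))) hK0
  linarith

end Covariance

end SmallAcceleration

end Optimality

end FTN

end

/-! ### Assembly of the three statements. -/

theorem mainTheorem4 (p G : ℝ → ℝ) (β T δ σ E : ℝ) (h : ℂ)
    (hβ0 : 0 ≤ β) (hβ1 : β ≤ 1) (hT : 0 < T) (hδ0 : 0 < δ) (hδ1 : δ ≤ 1)
    (hσ : 0 < σ) (hE : 0 < E) (hh : h ≠ 0) (hp : FTN.IsPulse p G β T) :
    -- for large blocks the Toeplitz matrix and its DFT form agree (in normalised Frobenius norm)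
    Tendsto (fun M : ℕ =>
        (∑ m, ∑ n, ‖FTN.gram p δ T M m n - FTN.gramDFT G δ T M m n‖ ^ 2) / FTN.blockLength M)
      atTop (𝓝 0) ∧
    -- moderate acceleration
    (1 / (1 + β) ≤ δ → ∀ M : ℕ,
      -- the Toeplitz channel matrix itself
      ((FTN.gram p δ T M).PosDef ∧
        ∀ S : FTN.BlockMatrix M,
          FTN.IsOptimalCov (FTN.infoRate h σ (FTN.gram p δ T M))
              (fun S' => FTN.snrRx T σ (FTN.symbolEnergy p δ T S')) (FTN.snrRx T σ E) S ↔
            S = FTN.covModerate (E / (δ * T)) δ T (FTN.gram p δ T M)) ∧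
      -- its DFT form
      ((FTN.gramDFT G δ T M).PosDef ∧
        ∀ S : FTN.BlockMatrix M,
          FTN.IsOptimalCov (FTN.infoRate h σ (FTN.gramDFT G δ T M))
              (fun S' => FTN.snrRx T σ (FTN.traceEnergy (FTN.gramDFT G δ T M) S'))
              (FTN.snrRx T σ E) S ↔
            S = FTN.covModerate (E / (δ * T)) δ T (FTN.gramDFT G δ T M))) ∧
    -- small acceleration
    (δ < 1 / (1 + β) →
      -- the optimal spectrum, unique up to null sets and up to frequencies that carry no signal
      (FTN.IsOptimalSpectrum G δ T h σ (FTN.snrRx T σ E)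
          (fun f => E / (δ * T) * δ * T * FTN.phi G β δ T f) ∧
        ∀ s : ℝ → ℝ, FTN.IsOptimalSpectrum G δ T h σ (FTN.snrRx T σ E) s →
          ∀ᵐ f ∂(volume.restrict (Set.Icc (-(1 / 2 : ℝ)) (1 / 2))),
            s f * FTN.foldedSpectrum G δ T f =
              E / (δ * T) * δ * T * FTN.phi G β δ T f * FTN.foldedSpectrum G δ T f) ∧
      -- the covariance matrix is made of the samples of this spectrum
      (∀ (M : ℕ) (i : ℤ), |i| ≤ (M : ℤ) →
        FTN.lamTilde G β δ T M i = FTN.phi G β δ T (i / FTN.blockLength M)) ∧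
      -- for each block length it is optimal at the received SNR that it has, and unique up to
      -- components that do not reach the receiver
      (∀ M : ℕ,
        FTN.IsOptimalCov (FTN.infoRate h σ (FTN.gramDFT G δ T M))
            (fun S' => FTN.snrRx T σ (FTN.traceEnergy (FTN.gramDFT G δ T M) S'))
            (FTN.snrRx T σ (FTN.traceEnergy (FTN.gramDFT G δ T M)
              (FTN.covSmall G β (E / (δ * T)) δ T M)))
            (FTN.covSmall G β (E / (δ * T)) δ T M) ∧
        ∀ S : FTN.BlockMatrix M,
          FTN.IsOptimalCov (FTN.infoRate h σ (FTN.gramDFT G δ T M))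
              (fun S' => FTN.snrRx T σ (FTN.traceEnergy (FTN.gramDFT G δ T M) S'))
              (FTN.snrRx T σ (FTN.traceEnergy (FTN.gramDFT G δ T M)
                (FTN.covSmall G β (E / (δ * T)) δ T M))) S →
            FTN.gramDFT G δ T M * S * FTN.gramDFT G δ T M =
              FTN.gramDFT G δ T M * FTN.covSmall G β (E / (δ * T)) δ T M *
                FTN.gramDFT G δ T M) ∧
      -- that received SNR tends to the prescribed one
      Tendsto (fun M : ℕ => FTN.snrRx T σ (FTN.traceEnergy (FTN.gramDFT G δ T M)
          (FTN.covSmall G β (E / (δ * T)) δ T M))) atTop (𝓝 (FTN.snrRx T σ E)) ∧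
      -- asymptotic optimality at the prescribed received SNR
      (∀ ε : ℝ, 0 < ε → ∀ᶠ M : ℕ in atTop, ∀ S : FTN.BlockMatrix M, S.PosSemidef →
        FTN.snrRx T σ (FTN.traceEnergy (FTN.gramDFT G δ T M) S) ≤ FTN.snrRx T σ E →
        FTN.infoRate h σ (FTN.gramDFT G δ T M) S ≤
          FTN.infoRate h σ (FTN.gramDFT G δ T M)
            (FTN.covSmall G β (E / (δ * T)) δ T M) + ε)) := by
  have hwidth : 0 < 1 + β := by linarith
  refine ⟨hp.tendsto_gram_sub_gramDFT hβ1 hT hδ0 hδ1, fun hδ M => ⟨?_, ?_⟩, fun hδ => ?_⟩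
  · have hpd := FTN.gram_posDef hβ0 hT hδ0 hp M
    refine ⟨hpd, fun S => ?_⟩
    simp only [FTN.symbolEnergy_eq_traceEnergy hp.finite_energy]
    exact FTN.isOptimalCov_iff_of_posDef hδ0 hT hE hh hσ hpd S
  · have hpd := hp.gramDFT_posDef hβ1 hT hδ0 hδ1 ((div_le_iff₀ hwidth).1 hδ) M
    exact ⟨hpd, FTN.isOptimalCov_iff_of_posDef hδ0 hT hE hh hσ hpd⟩
  · have hw : δ * (1 + β) < 1 := (lt_div_iff₀ hwidth).1 hδ
    have hcoef : E / (δ * T) * δ * T = E := by field_simp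
    rw [hcoef]
    refine ⟨⟨hp.isOptimalSpectrum_phi hβ0 hβ1 hT hδ0 hδ1 hw hE.le hh hσ,
        fun s hs => hs.ae_eq_phi hβ0 hβ1 hT hδ0 hδ1 hp hw hE.le hh hσ⟩,
      fun M i _ => hp.lamTilde_eq_phi hβ0 hT hδ0 hw M i,
      fun M => ⟨hp.isOptimalCov_covSmall hβ0 hβ1 hT hδ0 hδ1 hw hE.le hh hσ M,
        fun S hS => hS.gramDFT_mul_mul_eq hβ0 hβ1 hT hδ0 hδ1 hp hw hE.le hh hσ⟩, ?_,
      fun ε hε => ?_⟩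
    · exact ((hp.tendsto_traceEnergy_covSmall hβ0 hβ1 hT hδ0 hδ1 hw hE.le).div_const T).div_const _
    · simp only [FTN.snrRx_le_iff hT hσ]
      exact hp.eventually_infoRate_le hβ0 hβ1 hT hδ0 hδ1 hw hE.le hh hσ hε
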